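/- Conventions. "Algorithm" means a (uniform) classical probabilistic algorithm. For an integer $0\le y<2^n$ let $\mathrm{BIN}_n(y)\in\{0,1\}^n$ be its $n$-bit binary representation, and let $x\|y$ denote concatenation. Logarithms are to base 2 and $d_{\mathrm{KL}}(D,D')=\sum_x D(x)\log\frac{D(x)}{D'(x)}$ (which is $+\infty$ if $D(x)>0=D'(x)$ for some $x$). Pseudorandom functions. Let $\{F_P\}$ be an indexed collection of efficiently computable keyed functions $F_P:\mathcal K_P\times\{0,1\}^n\to\mathcal D'_P$ for $P\in\mathcal P_n$, where $\mathcal D'_P\subseteq\{0,\dots,2^n-1\}$ is non-empty and $\mathcal P_n$ is the set of possible values of an instance generation algorithm $\mathcal{IG}$ on input $1^n$; generating $P\leftarrow\mathcal{IG}(1^n)$, choosing a uniform key $k\in\mathcal K_P$ from $P$ (both samplers may have negligible statistical error), evaluating $F_P(k,x)$ from $(P,k,x)$, and recovering $n$ from $P\in\mathcal P_n$ are all possible in time polynomial in $n$. The collection is a classical-secure pseudorandom function collection if for every algorithm $\mathcal A$ with running time polynomial in $n$, every polynomial $p$ and all sufficiently large $n$, $$\Big|\Pr_{P\leftarrow\mathcal{IG}(1^n),\,k\leftarrow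 U(\mathcal K_P)}\big[\mathcal A^{F_P(k,\cdot)}(P)=1\big]-\Pr_{P\leftarrow\mathcal{IG}(1^n),\,R\leftarrow U(\{0,1\}^n\to\mathcal D'_P)}\big[\mathcal A^{R}(P)=1\big]\Big|<\frac1{p(n)},$$ where $\mathcal A$ has membership query access to the function in the exponent and $R$ is a uniformly random function from $\{0,1\}^n$ to $\mathcal D'_P$. Learning. For a set $\mathcal C_n$ of distributions on $\{0,1\}^{m}$, with $m=m(n)$, an $(\epsilon,\delta,\mathrm{SAMPLE},d_{\mathrm{KL}})$ PAC generator learner is an algorithm that, for every $D\in\mathcal C_n$, given $1^n$ and access to independent samples from $D$, outputs with probability at least $1-\delta$ a description of an algorithm which in time $\mathrm{poly}(n)$ generates samples from some distribution $D'$ on $\{0,1\}^m$ with $d_{\mathrm{KL}}(D,D')\le\epsilon$. It is efficient if its worst-case running time is at most a polynomial in $n,1/\delta,1/\epsilon$. The class is efficiently classically PAC generator-learnable with respect to $\mathrm{SAMPLE}$ and $d_{\mathrm{KL}}$ if there is an efficient learner for all $\epsilon>0$ and $0<\delta<1$. Theorem. Let $\{F_P\}$ be a classical-secure pseudorandom function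 collection as above such that, for all sufficiently large $n$, $|\mathcal D'_P|\ge 2$ for all $P\in\mathcal P_n$. For $P\in\mathcal P_n$ and $k\in\mathcal K_P$ let $\tilde D_{(P,k)}$ be the distribution on $\{0,1\}^{2n}$ of $x\|\mathrm{BIN}_n(F_P(k,x))$ for uniformly random $x\in\{0,1\}^n$, and let $\tilde{\mathcal C}_n=\{\tilde D_{(P,k)}: P\in\mathcal P_n,\ k\in\mathcal K_P\}$. Then for all sufficiently large $n$ the class $\tilde{\mathcal C}_n$ is not efficiently classically PAC generator-learnable with respect to the $\mathrm{SAMPLE}$ oracle and the KL divergence. That is: for every choice of learning algorithms $\mathcal A_{\epsilon,\delta}$ and of polynomials bounding the running times of the learners and of the generators they output (for all $\epsilon>0$, $0<\delta<1$), for all sufficiently large $n$ there are $\epsilon>0$ and $0<\delta<1$ such that $\mathcal A_{\epsilon,\delta}$ is not, within these time bounds, an $(\epsilon,\delta,\mathrm{SAMPLE},d_{\mathrm{KL}})$ PAC generator learner for $\tilde{\mathcal C}_n$. -/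

import Mathlib

open Filter

noncomputable section

namespace GeneratorLearning

/-! ### Bit strings -/

/-- The set `{0,1}^n`; the coordinate `0` is the leftmost bit. -/
abbrev Bits (n : ℕ) : Type := Fin n → Bool

/-- `BIN_n(y)`: the `n`-bit binary representation of `y < 2 ^ n`, most significant bit first. -/
def bin (n : ℕ) (y : ℕ) : Bits n := fun i => y.testBit i.rev

/-- The unary security parameter `1^n`. -/
def unary (n : ℕ) : List Bool := List.replicate n true

/-! ### Probabilistic oracle programs and their running time

The machine model is that of programs over finitely many stacks of bits (the number of stacks is
fixed by the program), which is the multi-tape Turing machine up to a polynomial overhead. Every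
elementary action costs one step. Fair coins and oracle calls are primitive. -/

/-- An oracle: it answers a query string with a random answer string. The randomness is fresh in
each call. -/
abbrev Oracle : Type := List Bool → PMF (List Bool)

/-- Programs. Registers are numbered by `ℕ` and each holds a stack of bits. -/
inductive Prog : Type
  /-- do nothing -/
  | skip : Prog
  /-- push the bit `b` on register `r` -/
  | push (r : ℕ) (b : Bool) : Prog
  /-- remove the top bit of register `r` -/
  | pop (r : ℕ) : Prog
  /-- push a fair coin toss on register `r` -/
  | flip (r : ℕ) : Prog
  /-- submit the content of register `q` to the oracle and store its answer in register `r` -/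
  | query (q r : ℕ) : Prog
  /-- run `p`, then `p'` -/
  | seq (p p' : Prog) : Prog
  /-- case distinction on register `r`: empty, top bit `false`, top bit `true` -/
  | branch (r : ℕ) (pnil pfalse ptrue : Prog) : Prog
  /-- repeat `p` as long as register `r` is not empty -/
  | loop (r : ℕ) (p : Prog) : Prog

/-- Contents of the registers. -/
abbrev Store : Type := ℕ → List Bool

/-- A configuration: the programs that remain to be executed, and the registers. The
computation has halted when no program remains. -/
abbrev Config : Type := List Prog × Store

/-- One step of computation. -/
def step (O : Oracle) : Config → PMF Config
  | ([], s) => PMF.pure ([], s)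
  | (Prog.skip :: K, s) => PMF.pure (K, s)
  | (Prog.push r b :: K, s) => PMF.pure (K, Function.update s r (b :: s r))
  | (Prog.pop r :: K, s) => PMF.pure (K, Function.update s r (s r).tail)
  | (Prog.flip r :: K, s) =>
      (PMF.uniformOfFintype Bool).map fun b => (K, Function.update s r (b :: s r))
  | (Prog.query q r :: K, s) => (O (s q)).map fun a => (K, Function.update s r a)
  | (Prog.seq p p' :: K, s) => PMF.pure (p :: p' :: K, s)
  | (Prog.branch r pnil pfalse ptrue :: K, s) =>
      PMF.pure (match s r with
        | [] => (pnil :: K, s)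
        | false :: _ => (pfalse :: K, s)
        | true :: _ => (ptrue :: K, s))
  | (Prog.loop r p :: K, s) =>
      PMF.pure (match s r with
        | [] => (K, s)
        | _ :: _ => (p :: Prog.loop r p :: K, s))

/-- The random configuration after `t` steps. -/
def steps (O : Oracle) : ℕ → Config → PMF Config
  | 0, c => PMF.pure c
  | t + 1, c => (step O c).bind (steps O t)

/-- Initially, register `i` holds the `i`-th input, and all further registers are empty. -/
def initStore (inputs : List (List Bool)) : Store := fun i => inputs.getD i []

/-- The output of a halted configuration is the content of register `0`. -/
def output : Config → Option (List Bool)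
  | ([], s) => some (s 0)
  | (_ :: _, _) => none

/-- The law of the output of the program `M` with oracle `O` on the given inputs, when it is
allowed `t` steps. The value `none` means that `M` has not halted within `t` steps. -/
def Prog.law (M : Prog) (O : Oracle) (inputs : List (List Bool)) (t : ℕ) :
    PMF (Option (List Bool)) :=
  (steps O t ([M], initStore inputs)).map output

/-- The oracle of the algorithms that have none. -/
def noOracle : Oracle := fun _ => PMF.pure []

/-- Membership query oracle `MQ(f)` of a function `f` on `{0,1}^n` with values below `2 ^ n`:
on the query `x` it returns `f x`, written as `BIN_n (f x)`. -/
def MQ {n : ℕ} (f : Bits n → ℕ) : Oracle := fun q =>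
  if h : q.length = n then PMF.pure (List.ofFn (bin n (f fun i => q.get (i.cast h.symm))))
  else PMF.pure []

/-- The oracle `SAMPLE(D)`, which returns an independent sample from `D` whenever invoked. -/
def SAMPLE {m : ℕ} (D : PMF (Bits m)) : Oracle := fun _ => D.map List.ofFn

/-! ### Collections of keyed functions and pseudorandomness -/

/-- A collection of keyed functions `F_P : K_P × {0,1}^n → D'_P`, with `D'_P ⊆ {0,1}^n` for every
parameterization `P` in `𝒫_n`. Parameterizations and keys are given by bit strings. What is
attached to a string `P` that belongs to no `𝒫_n` is irrelevant. -/
structure KeyedFunctions where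
  /-- the distribution of the parameterization `IG(1^n)` -/
  ig : ℕ → PMF (List Bool)
  /-- the key space `K_P` -/
  key : List Bool → Finset (List Bool)
  key_nonempty : ∀ P, (key P).Nonempty
  /-- the codomain `D'_P`, a finite set of non-negative integers -/
  cod : List Bool → Finset ℕ
  cod_nonempty : ∀ P, (cod P).Nonempty
  /-- `F n P k x` is `F_P(k,x)`, for `P ∈ 𝒫_n` -/
  F : (n : ℕ) → List Bool → List Bool → Bits n → ℕ
  F_mem : ∀ n, ∀ P ∈ (ig n).support, ∀ k ∈ key P, ∀ x, F n P k x ∈ cod P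
  /-- `D'_P ⊆ {0,1}^n`, that is, `BIN_n(y)` exists for all `y ∈ D'_P` -/
  cod_lt : ∀ n, ∀ P ∈ (ig n).support, ∀ y ∈ cod P, y < 2 ^ n

namespace KeyedFunctions

variable (C : KeyedFunctions)

/-- `𝒫_n`, the set of possible values of `IG(1^n)`. -/
def params (n : ℕ) : Set (List Bool) := (C.ig n).support

/-- `U(K_P)` -/
def randomKey (P : List Bool) : PMF (List Bool) :=
  PMF.uniformOfFinset (C.key P) (C.key_nonempty P)

/-- The uniform distribution over all functions `{0,1}^n → D'_P`. -/
def randomFunction (n : ℕ) (P : List Bool) : PMF (Bits n → ℕ) :=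
  PMF.uniformOfFinset (Fintype.piFinset fun _ : Bits n => C.cod P)
    (Fintype.piFinset_nonempty.2 fun _ => C.cod_nonempty P)

end KeyedFunctions

/-- The law `μ` of the output of a (time-bounded) algorithm is within statistical distance `η` of
the target distribution `D`. -/
def StatClose (μ : PMF (Option (List Bool))) (D : PMF (List Bool)) (η : ℝ) : Prop :=
  ∀ E : Set (Option (List Bool)),
    |(μ.toOuterMeasure E).toReal - ((D.map some).toOuterMeasure E).toReal| < η

/-- The algorithms that come with an indexed collection of efficiently computable keyed functions,
all of them in time polynomial in `n`: instance generation, selection of a uniform key, evaluation,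
and recovery of `n` from `P ∈ 𝒫_n`. The two sampling algorithms may have a negligible statistical
error, since with fair coins and a bounded running time no exact sampling exists unless all
probabilities are dyadic; exact samplers are included. -/
structure KeyedFunctions.EfficientlyComputable (C : KeyedFunctions) : Prop where
  instanceGeneration : ∃ (M : Prog) (t : Polynomial ℕ), ∀ p : Polynomial ℕ, p ≠ 0 →
    ∀ᶠ n : ℕ in atTop,
      StatClose (M.law noOracle [unary n] (t.eval n)) (C.ig n) (1 / (p.eval n : ℕ))
  keySelection : ∃ (M : Prog) (t : Polynomial ℕ), ∀ p : Polynomial ℕ, p ≠ 0 →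
    ∀ᶠ n : ℕ in atTop, ∀ P ∈ C.params n,
      StatClose (M.law noOracle [P] (t.eval n)) (C.randomKey P) (1 / (p.eval n : ℕ))
  evaluation : ∃ (M : Prog) (t : Polynomial ℕ), ∀ n, ∀ P ∈ C.params n, ∀ k ∈ C.key P,
    ∀ x : Bits n, M.law noOracle [P, k, List.ofFn x] (t.eval n) =
      PMF.pure (some (List.ofFn (bin n (C.F n P k x))))
  recovery : ∃ (M : Prog) (t : Polynomial ℕ), ∀ n, ∀ P ∈ C.params n,
    M.law noOracle [P] (t.eval n) = PMF.pure (some (unary n))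

/-- `Pr[A^{MQ(F_P(k,·))}(P) = 1]` over `P ← IG(1^n)`, `k ← U(K_P)` and the coins of `A`, which is
stopped after `t` steps. -/
def KeyedFunctions.probReal (C : KeyedFunctions) (A : Prog) (n t : ℕ) : ℝ :=
  (((C.ig n).bind fun P => (C.randomKey P).bind fun k =>
    A.law (MQ (C.F n P k)) [P] t) (some [true])).toReal

/-- `Pr[A^{MQ(R)}(P) = 1]` over `P ← IG(1^n)`, `R` uniform among the functions `{0,1}^n → D'_P`,
and the coins of `A`, which is stopped after `t` steps. -/
def KeyedFunctions.probRandom (C : KeyedFunctions) (A : Prog) (n t : ℕ) : ℝ :=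
  (((C.ig n).bind fun P => (C.randomFunction n P).bind fun R =>
    A.law (MQ R) [P] t) (some [true])).toReal

/-- Classical-secure pseudorandom function collections: no probabilistic polynomial time adversary
(a program `A` with a polynomial clock `t`) with membership queries distinguishes `F_P(k,·)` from a
random function with non-negligible advantage. -/
structure KeyedFunctions.ClassicalSecurePRF (C : KeyedFunctions) : Prop where
  efficient : C.EfficientlyComputable
  pseudorandom : ∀ (A : Prog) (t p : Polynomial ℕ), p ≠ 0 → ∀ᶠ n : ℕ in atTop,
    |C.probReal A n (t.eval n) - C.probRandom A n (t.eval n)| < 1 / (p.eval n : ℕ)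

/-! ### The distribution concept class -/

/-- `KGEN_{(P,k)}(x) = x || BIN_n(F_P(k,x))` -/
def KeyedFunctions.kgen (C : KeyedFunctions) (n : ℕ) (P k : List Bool) (x : Bits n) :
    Bits (n + n) :=
  Fin.append x (bin n (C.F n P k x))

/-- `D̃_{(P,k)}`, the distribution of `KGEN_{(P,k)}(x)` for uniform `x`. -/
def KeyedFunctions.kdist (C : KeyedFunctions) (n : ℕ) (P k : List Bool) : PMF (Bits (n + n)) :=
  (PMF.uniformOfFintype (Bits n)).map (C.kgen n P k)

/-- The distribution concept class `{D̃_{(P,k)} | P ∈ 𝒫_n, k ∈ K_P}`. -/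
def KeyedFunctions.conceptClass (C : KeyedFunctions) (n : ℕ) : Set (PMF (Bits (n + n))) :=
  {D | ∃ P ∈ C.params n, ∃ k ∈ C.key P, D = C.kdist n P k}

/-! ### PAC generator learning -/

/-- The Kullback-Leibler divergence, with logarithms to base `2`; it is infinite if some point has
positive `D`-mass and no `D'`-mass. -/
def dKL {m : ℕ} (D D' : PMF (Bits m)) : EReal :=
  open Classical in
  if ∀ x, D' x = 0 → D x = 0 then
    ((∑ x, (D x).toReal * Real.logb 2 ((D x).toReal / (D' x).toReal) : ℝ) : EReal)
  else ⊤

/-- A classical learning algorithm for generators. On input `1^n`, and with access to an oracle, the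
program `learn` outputs the description `h` of a generator. A description `h` denotes the
probabilistic algorithm that runs `gen` on `1^n` and `h`; no restriction is put on how
generators are described (a program, a circuit, a key, ...). -/
structure GeneratorLearner where
  learn : Prog
  gen : Prog

/-- `h` describes a generator for the distribution `D'` on `{0,1}^m` that always halts within `t`
steps. -/
def GeneratorLearner.Generates (L : GeneratorLearner) (n t : ℕ) (h : List Bool) {m : ℕ}
    (D' : PMF (Bits m)) : Prop :=
  L.gen.law noOracle [unary n, h] t = D'.map fun y => some (List.ofFn y)

/-- `L` is an `(ε, δ, O, d)` PAC generator learner for the concept class `𝒞`: for all `D ∈ 𝒞`, with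
access to `O(D)`, it always halts within `T` steps, and with probability at least `1 - δ` it
outputs a `(d, ε)` generator for `D`, whose running time is at most `t`. -/
def GeneratorLearner.IsPACLearner (L : GeneratorLearner) (n : ℕ) {m : ℕ} (𝒞 : Set (PMF (Bits m)))
    (ε δ : ℝ) (O : PMF (Bits m) → Oracle) (d : PMF (Bits m) → PMF (Bits m) → EReal) (T t : ℕ) :
    Prop :=
  ∀ D ∈ 𝒞,
    none ∉ (L.learn.law (O D) [unary n] T).support ∧
    ENNReal.ofReal (1 - δ) ≤ (L.learn.law (O D) [unary n] T).toOuterMeasure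
      {o | ∃ h : List Bool, o = some h ∧
        ∃ D' : PMF (Bits m), L.Generates n t h D' ∧ d D D' ≤ (ε : EReal)}

/-- The algorithms `𝓛 ε δ` show that `𝒞`, a concept class over `{0,1}^m` with index `n`, is
efficiently PAC generator-learnable with respect to the oracle `O` and the distance measure `d`:
for all `ε > 0` and `0 < δ < 1`, `𝓛 ε δ` is an `(ε, δ, O, d)` PAC generator learner with running
time at most a polynomial in `n, 1/δ, 1/ε`, and its generators run in time polynomial in `n`.
The polynomials are given by `c ε δ`, so they may even differ for different `ε` and `δ`. -/
def EfficientlyLearns (𝓛 : ℝ → ℝ → GeneratorLearner) (c : ℝ → ℝ → ℕ) (n : ℕ) {m : ℕ}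
    (𝒞 : Set (PMF (Bits m))) (O : PMF (Bits m) → Oracle)
    (d : PMF (Bits m) → PMF (Bits m) → EReal) : Prop :=
  ∀ ε δ : ℝ, 0 < ε → 0 < δ → δ < 1 →
    (𝓛 ε δ).IsPACLearner n 𝒞 ε δ O d
      ⌊(c ε δ : ℝ) * ((n : ℝ) + 1 / δ + 1 / ε) ^ (c ε δ)⌋₊
      (c ε δ * (n + 1) ^ (c ε δ))

end GeneratorLearning

end

open GeneratorLearning

/-!
# Generators for the graphs of pseudorandom functions cannot be learned

Suppose that learners existed for some large `n`. Only the learner for `ε = δ = 1 / 10` is needed: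
together with the programs that recover `n` from `P` and run generators it gives a distinguisher
`Prog.distinguisher` with membership queries to a function `f`. It runs the learner, simulating
each sample by a query of `f` at a uniformly random point `x` and recording `x`, then runs the
generator found by the learner once, to obtain a string `x || y`. It accepts if `y = f x` and `x` is
fresh, that is, different from all recorded points. Without the freshness condition a learner that
simply memorizes its sample would lead to acceptance for every `f`.

* For `f = F_P(k, ·)`, a good generator has a law `D'` with `dKL D D' ≤ 1 / 10`, where `D` is
  uniform on the graph of `f`. Elementary bounds for the logarithm show that `D'` gives mass at least
  `7 / 10` to the points of the graph outside of the sample, since the latter is of polynomial size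
  (`le_sum_of_dKL_le`, `le_freshProb`). The distinguisher accepts with probability at least
  `9 / 10 * 7 / 10` (`le_learnProb`).
* For a random function `f`, the run of the learner does not depend on the value of `f` at any point
  outside of the sample. Exchanging two values in the codomain at such a point preserves the uniform
  law, so that every value has conditional probability at most `1 / 2`. The distinguisher accepts
  with probability at most `1 / 2` (`expect_learnProb_le`).

The difference of the two probabilities contradicts pseudorandomness. What has to be shown for the
machine model is that the distinguisher computes what is claimed, in polynomial time. Deterministic
subroutines are handled by a calculus of exact running times (`Runs`, `Yields`). A program that is
run as a subroutine has its registers renamed and its oracle calls replaced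
(`Prog.embed`); the acceptance probability of the whole is compared with the law of the subroutine
in both directions (`expect_haltedProb_le`, `acceptProb_simConfig_le`), because nothing is known
about the running time of the learner when its samples come from a random function.
-/

namespace GeneratorLearning

open scoped ENNReal

/-! ### Expectations of non-negative functions -/

/-- The expectation of a function with values in `[0, ∞]`. -/
noncomputable def expect {α : Type*} (μ : PMF α) (f : α → ℝ≥0∞) : ℝ≥0∞ := ∑' a, μ a * f a

section expect

variable {α β : Type*}

@[simp]
lemma expect_pure (a : α) (f : α → ℝ≥0∞) : expect (PMF.pure a) f = f a := by
  classical
  rw [expect, tsum_eq_single a]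
  · simp
  · intro b hb
    simp [hb]

lemma expect_comm (μ : PMF α) (ν : PMF β) (f : α → β → ℝ≥0∞) :
    expect μ (fun a => expect ν (f a)) = expect ν (fun b => expect μ (fun a => f a b)) := by
  simp only [expect, ← ENNReal.tsum_mul_left]
  rw [ENNReal.tsum_comm]
  simp only [mul_left_comm]

lemma expect_bind (μ : PMF α) (ν : α → PMF β) (f : β → ℝ≥0∞) :
    expect (μ.bind ν) f = expect μ (fun a => expect (ν a) f) := by
  simp only [expect, PMF.bind_apply, ← ENNReal.tsum_mul_left, ← ENNReal.tsum_mul_right]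
  rw [ENNReal.tsum_comm]
  simp only [mul_assoc]

@[simp]
lemma expect_map (μ : PMF α) (g : α → β) (f : β → ℝ≥0∞) :
    expect (μ.map g) f = expect μ (fun a => f (g a)) := by
  rw [PMF.map, expect_bind]
  simp

lemma expect_mono {μ : PMF α} {f g : α → ℝ≥0∞} (h : ∀ a ∈ μ.support, f a ≤ g a) :
    expect μ f ≤ expect μ g := by
  refine ENNReal.tsum_le_tsum fun a => ?_
  by_cases ha : μ a = 0
  · simp [ha]
  · exact mul_le_mul_right (h a ((PMF.mem_support_iff _ _).2 ha)) _

@[simp]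
lemma expect_const (μ : PMF α) (r : ℝ≥0∞) : expect μ (fun _ => r) = r := by
  rw [expect, ENNReal.tsum_mul_right, PMF.tsum_coe, one_mul]

lemma expect_mul_right (μ : PMF α) (f : α → ℝ≥0∞) (r : ℝ≥0∞) :
    expect μ (fun a => f a * r) = expect μ f * r := by
  simp only [expect, ← ENNReal.tsum_mul_right, mul_assoc]

lemma expect_le {μ : PMF α} {f : α → ℝ≥0∞} {r : ℝ≥0∞} (h : ∀ a ∈ μ.support, f a ≤ r) :
    expect μ f ≤ r :=
  (expect_mono h).trans_eq (expect_const μ r)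

lemma le_expect {μ : PMF α} {f : α → ℝ≥0∞} {r : ℝ≥0∞} (h : ∀ a ∈ μ.support, r ≤ f a) :
    r ≤ expect μ f :=
  (expect_const μ r).symm.trans_le (expect_mono h)

lemma expect_indicator (μ : PMF α) (E : Set α) [DecidablePred (· ∈ E)] :
    expect μ (fun a => if a ∈ E then 1 else 0) = μ.toOuterMeasure E := by
  rw [PMF.toOuterMeasure_apply, expect]
  refine tsum_congr fun a => ?_
  by_cases h : a ∈ E <;> simp [h]

lemma bind_congr_support {μ : PMF α} {f g : α → PMF β} (h : ∀ a ∈ μ.support, f a = g a) :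
    μ.bind f = μ.bind g := by
  ext b
  simp only [PMF.bind_apply]
  refine tsum_congr fun a => ?_
  by_cases ha : μ a = 0
  · simp [ha]
  · rw [h a ((PMF.mem_support_iff _ _).2 ha)]

end expect

/-! ### Acceptance probabilities -/

lemma steps_succ (O : Oracle) (t : ℕ) (c : Config) :
    steps O (t + 1) c = (step O c).bind (steps O t) := rfl

lemma steps_zero (O : Oracle) (c : Config) : steps O 0 c = PMF.pure c := rfl

lemma steps_add (O : Oracle) (m t : ℕ) (c : Config) :
    steps O (m + t) c = (steps O m c).bind (steps O t) := by
  induction m generalizing c with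
  | zero => simp [steps_zero]
  | succ m ih =>
    rw [Nat.succ_add, steps_succ, steps_succ, PMF.bind_bind]
    exact congrArg _ (funext ih)

lemma steps_nil (O : Oracle) (t : ℕ) (s : Store) : steps O t ([], s) = PMF.pure ([], s) := by
  induction t with
  | zero => rfl
  | succ t ih => rw [steps_succ, step, PMF.pure_bind, ih]

/-- The probability that the configuration `c` halts with output `1` within `t` steps. -/
noncomputable def acceptProb (O : Oracle) (t : ℕ) (c : Config) : ℝ≥0∞ :=
  expect (steps O t c) fun c' => if output c' = some [true] then 1 else 0

lemma law_apply_true (M : Prog) (O : Oracle) (inputs : List (List Bool)) (t : ℕ) :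
    M.law O inputs t (some [true]) = acceptProb O t ([M], initStore inputs) := by
  rw [Prog.law, PMF.map_apply, acceptProb, expect]
  refine tsum_congr fun c => ?_
  by_cases h : output c = some [true] <;> simp [h, eq_comm]

lemma acceptProb_add (O : Oracle) (m t : ℕ) (c : Config) :
    acceptProb O (m + t) c = expect (steps O m c) (acceptProb O t) := by
  rw [acceptProb, steps_add, expect_bind]
  rfl

lemma acceptProb_zero_cons (O : Oracle) (p : Prog) (K : List Prog) (s : Store) :
    acceptProb O 0 (p :: K, s) = 0 := by
  simp [acceptProb, steps_zero, output]

lemma acceptProb_nil (O : Oracle) (t : ℕ) (s : Store) :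
    acceptProb O t ([], s) = if s 0 = [true] then 1 else 0 := by
  simp [acceptProb, steps_nil, output]

/-- A halted configuration does not change any more. -/
lemma acceptProb_mono (O : Oracle) {t t' : ℕ} (h : t ≤ t') (c : Config) :
    acceptProb O t c ≤ acceptProb O t' c := by
  obtain ⟨d, rfl⟩ := Nat.exists_eq_add_of_le h
  rw [acceptProb_add]
  refine expect_mono fun c' _ => ?_
  rcases c' with ⟨_ | ⟨p, K⟩, s⟩
  · simp [acceptProb_nil, output]
  · simp [output]

/-! ### A calculus for the execution of programs -/

/-- Whatever remains to be executed afterwards, `p` terminates on the store `s` after exactly `m`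
steps, and the resulting store has the law `μ`. -/
def Yields (O : Oracle) (p : Prog) (s : Store) (m : ℕ) (μ : PMF Store) : Prop :=
  ∀ K, steps O m (p :: K, s) = μ.map fun s' => (K, s')

/-- `p` transforms the store `s` into `s'` in exactly `m` steps, with probability `1`. -/
def Runs (O : Oracle) (p : Prog) (s : Store) (m : ℕ) (s' : Store) : Prop :=
  ∀ K, steps O m (p :: K, s) = PMF.pure (K, s')

section calculus

variable {O : Oracle} {p p' pn pf pt : Prog} {s s' s'' : Store} {m m' : ℕ}

lemma Runs.yields (h : Runs O p s m s') : Yields O p s m (PMF.pure s') := by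
  intro K
  rw [h K, PMF.pure_map]

lemma Runs.acceptProb_add (h : Runs O p s m s') (t : ℕ) (K : List Prog) :
    acceptProb O (m + t) (p :: K, s) = acceptProb O t (K, s') := by
  rw [GeneratorLearning.acceptProb_add, h K, expect_pure]

lemma Runs.acceptProb_le (h : Runs O p s m s') (t : ℕ) (K : List Prog) :
    acceptProb O t (p :: K, s) ≤ acceptProb O t (K, s') :=
  (acceptProb_mono O (Nat.le_add_left t m) _).trans_eq (h.acceptProb_add t K)

lemma Runs.congr (h : Runs O p s m s') (hm : m = m') (hs : s' = s'') : Runs O p s m' s'' := by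
  subst hm hs
  exact h

lemma runs_one_of_step (h : ∀ K, step O (p :: K, s) = PMF.pure (K, s')) : Runs O p s 1 s' := by
  intro K
  rw [show (1 : ℕ) = 0 + 1 from rfl, steps_succ, h, PMF.pure_bind, steps_zero]

lemma runs_skip : Runs O .skip s 1 s := runs_one_of_step fun _ => rfl

lemma runs_push (r : ℕ) (b : Bool) : Runs O (.push r b) s 1 (Function.update s r (b :: s r)) :=
  runs_one_of_step fun _ => rfl

lemma runs_pop (r : ℕ) : Runs O (.pop r) s 1 (Function.update s r (s r).tail) :=
  runs_one_of_step fun _ => rfl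

lemma runs_query {q r : ℕ} {a : List Bool} (h : O (s q) = PMF.pure a) :
    Runs O (.query q r) s 1 (Function.update s r a) :=
  runs_one_of_step fun K => by rw [step, h, PMF.pure_map]

lemma steps_succ_of_step {c c' : Config} (h : step O c = PMF.pure c') (t : ℕ) :
    steps O (t + 1) c = steps O t c' := by
  rw [steps_succ, h, PMF.pure_bind]

lemma Runs.seq (h : Runs O p s m s') (h' : Runs O p' s' m' s'') :
    Runs O (.seq p p') s (m + m' + 1) s'' := by
  intro K
  rw [steps_succ_of_step (c' := (p :: p' :: K, s)) rfl, steps_add, h, PMF.pure_bind, h']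

lemma Yields.seq {μ : PMF Store} {ν : Store → PMF Store} (h : Yields O p s m μ)
    (h' : ∀ s' ∈ μ.support, Yields O p' s' m' (ν s')) :
    Yields O (.seq p p') s (m + m' + 1) (μ.bind ν) := by
  intro K
  rw [steps_succ_of_step (c' := (p :: p' :: K, s)) rfl, steps_add, h, PMF.bind_map, PMF.map_bind]
  exact bind_congr_support fun s' hs' => h' s' hs' K

/-- A random computation followed by a deterministic one whose running time is always the same. -/
lemma Yields.seq_runs {β : Type*} {μ : PMF β} {g g' : β → Store} (h : Yields O p s m (μ.map g))
    (h' : ∀ b, Runs O p' (g b) m' (g' b)) :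
    Yields O (.seq p p') s (m + m' + 1) (μ.map g') := by
  intro K
  rw [steps_succ_of_step (c' := (p :: p' :: K, s)) rfl, steps_add, h, PMF.map_comp, PMF.bind_map,
    PMF.map_comp, ← PMF.bind_pure_comp]
  exact congrArg _ (funext fun b => h' b K)

lemma yields_flip (r : ℕ) : Yields O (.flip r) s 1
    ((PMF.uniformOfFintype Bool).map fun b => Function.update s r (b :: s r)) := by
  intro K
  rw [show (1 : ℕ) = 0 + 1 from rfl, steps_succ, step, PMF.bind_map, PMF.map_comp]
  rfl

lemma runs_branch_nil {r : ℕ} (hr : s r = []) (h : Runs O pn s m s') :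
    Runs O (.branch r pn pf pt) s (m + 1) s' := by
  intro K
  rw [steps_succ_of_step (c' := (pn :: K, s)) (by simp [step, hr]), h]

lemma runs_branch_false {r : ℕ} {l : List Bool} (hr : s r = false :: l) (h : Runs O pf s m s') :
    Runs O (.branch r pn pf pt) s (m + 1) s' := by
  intro K
  rw [steps_succ_of_step (c' := (pf :: K, s)) (by simp [step, hr]), h]

lemma runs_branch_true {r : ℕ} {l : List Bool} (hr : s r = true :: l) (h : Runs O pt s m s') :
    Runs O (.branch r pn pf pt) s (m + 1) s' := by
  intro K
  rw [steps_succ_of_step (c' := (pt :: K, s)) (by simp [step, hr]), h]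

lemma runs_loop_nil {r : ℕ} (hr : s r = []) : Runs O (.loop r p) s 1 s :=
  runs_one_of_step fun K => by simp [step, hr]

lemma runs_loop_cons {r : ℕ} {b : Bool} {l : List Bool} (hr : s r = b :: l) (h : Runs O p s m s')
    (h' : Runs O (.loop r p) s' m' s'') : Runs O (.loop r p) s (m + m' + 1) s'' := by
  intro K
  rw [steps_succ_of_step (c' := (p :: .loop r p :: K, s)) (by simp [step, hr]), steps_add, h,
    PMF.pure_bind, h']

lemma yields_loop_cons {r : ℕ} {b : Bool} {l : List Bool} {μ : PMF Store} {ν : Store → PMF Store}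
    (hr : s r = b :: l) (h : Yields O p s m μ)
    (h' : ∀ s' ∈ μ.support, Yields O (.loop r p) s' m' (ν s')) :
    Yields O (.loop r p) s (m + m' + 1) (μ.bind ν) := by
  intro K
  rw [steps_succ_of_step (c' := (p :: .loop r p :: K, s)) (by simp [step, hr]), steps_add, h,
    PMF.bind_map, PMF.map_bind]
  exact bind_congr_support fun s' hs' => h' s' hs' K

end calculus

/-! ### Machines whose oracle keeps a state -/

/-- An oracle that ignores the query string, but has an internal state which is changed by every
call. -/
abbrev StatefulOracle (α : Type) : Type := α → PMF (List Bool × α)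

/-- One step of computation with a stateful oracle. -/
noncomputable def sstep {α : Type} (Ω : StatefulOracle α) : Config × α → PMF (Config × α)
  | ((.query _ r :: K, s), a) => (Ω a).map fun x => ((K, Function.update s r x.1), x.2)
  | (c, a) => (step noOracle c).map fun c' => (c', a)

/-- The random configuration and the oracle state after `t` steps. -/
noncomputable def ssteps {α : Type} (Ω : StatefulOracle α) : ℕ → Config × α → PMF (Config × α)
  | 0, x => PMF.pure x
  | t + 1, x => (sstep Ω x).bind (ssteps Ω t)

section stateful

variable {α : Type} {Ω : StatefulOracle α}

lemma ssteps_nil (t : ℕ) (s : Store) (a : α) :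
    ssteps Ω t (([], s), a) = PMF.pure (([], s), a) := by
  induction t with
  | zero => rfl
  | succ t ih =>
    rw [ssteps, sstep, step, PMF.pure_map, PMF.pure_bind, ih]
    simp

/-- If the answers of the stateful oracle do not depend on its state, then it is an ordinary oracle
as far as the configurations of the machine are concerned. -/
lemma ssteps_map_fst {O : Oracle} (hO : ∀ a q, (Ω a).map Prod.fst = O q) (t : ℕ)
    (x : Config × α) : (ssteps Ω t x).map Prod.fst = steps O t x.1 := by
  have hstep : ∀ x : Config × α, (sstep Ω x).map Prod.fst = step O x.1 := by
    rintro ⟨⟨_ | ⟨p, K⟩, s⟩, a⟩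
    · simp [sstep, step, PMF.pure_map]
    · cases p with
      | query q r =>
        simp only [sstep, step, PMF.map_comp, ← hO a (s q)]
        rfl
      | flip r =>
        simp only [sstep, step, PMF.map_comp]
        rfl
      | _ => simp [sstep, step, PMF.pure_map]
  induction t generalizing x with
  | zero => simp [ssteps, steps_zero, PMF.pure_map]
  | succ t ih =>
    rw [ssteps, steps_succ, PMF.map_bind, ← hstep, PMF.bind_map]
    exact congrArg _ (funext ih)

end stateful

/-! ### Simulation of a machine within a larger program -/

/-- The program `p`, with registers renamed by `ρ`, and with the subroutine `Q r` in place of a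
query whose answer goes to the register `r` of `p`. -/
def Prog.embed (ρ : ℕ → ℕ) (Q : ℕ → Prog) : Prog → Prog
  | .skip => .skip
  | .push r b => .push (ρ r) b
  | .pop r => .pop (ρ r)
  | .flip r => .flip (ρ r)
  | .query _ r => Q r
  | .seq p p' => .seq (p.embed ρ Q) (p'.embed ρ Q)
  | .branch r pn pf pt => .branch (ρ r) (pn.embed ρ Q) (pf.embed ρ Q) (pt.embed ρ Q)
  | .loop r p => .loop (ρ r) (p.embed ρ Q)

/-- The store that holds the registers of `s` at the places given by `ρ`, and is equal to `b` on all
other registers. -/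
noncomputable def place (ρ : ℕ → ℕ) (s b : Store) : Store := Function.extend ρ s b

section place

variable {ρ : ℕ → ℕ}

lemma place_apply (hρ : ρ.Injective) (s b : Store) (r : ℕ) : place ρ s b (ρ r) = s r :=
  hρ.extend_apply _ _ _

lemma place_update (hρ : ρ.Injective) (s b : Store) (r : ℕ) (l : List Bool) :
    place ρ (Function.update s r l) b = Function.update (place ρ s b) (ρ r) l := by
  funext i
  by_cases hi : ∃ r', ρ r' = i
  · obtain ⟨r', rfl⟩ := hi
    by_cases h : r' = r
    · subst h
      simp [place_apply hρ]
    · rw [place_apply hρ, Function.update_of_ne h, Function.update_of_ne (hρ.ne h), place_apply hρ]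
  · have h : i ≠ ρ r := fun h => hi ⟨r, h.symm⟩
    rw [Function.update_of_ne h, place, place, Function.extend_apply' _ _ _ hi,
      Function.extend_apply' _ _ _ hi]

lemma place_of_notMem (s b : Store) {i : ℕ} (hi : ¬ ∃ r, ρ r = i) : place ρ s b i = b i :=
  Function.extend_apply' _ _ _ hi

lemma eq_place (hρ : ρ.Injective) {s b : Store} (h : ∀ r, b (ρ r) = s r) : b = place ρ s b := by
  funext i
  by_cases hi : ∃ r', ρ r' = i
  · obtain ⟨r', rfl⟩ := hi
    rw [place_apply hρ, h]
  · rw [place_of_notMem _ _ hi]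

end place

/-- The subroutines `Q r` simulate the stateful oracle `Ω` in `m` steps; the state `a` of the oracle
is held by the registers `base a`, which are not used by the simulated machine. -/
def SimulatesOracle {α : Type} (O : Oracle) (ρ : ℕ → ℕ) (Q : ℕ → Prog) (Ω : StatefulOracle α)
    (base : α → Store) (m : ℕ) : Prop :=
  ∀ (s : Store) (a : α) (r : ℕ), Yields O (Q r) (place ρ s (base a)) m
    ((Ω a).map fun x => place ρ (Function.update s r x.1) (base x.2))

section simulation

variable {α : Type} {O : Oracle} {ρ : ℕ → ℕ} {Q : ℕ → Prog} {Ω : StatefulOracle α}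
  {base : α → Store} {m : ℕ}

/-- The configuration of the simulating program that corresponds to a configuration of the simulated
machine and a state of its oracle; `K` is what remains to be done after the simulation. -/
noncomputable def simConfig (ρ : ℕ → ℕ) (Q : ℕ → Prog) (base : α → Store) (K : List Prog)
    (x : Config × α) : Config :=
  (x.1.1.map (Prog.embed ρ Q) ++ K, place ρ x.1.2 (base x.2))

/-- A step of the simulated machine is a positive and bounded number of steps of the simulation. -/
lemma exists_steps_simConfig (hρ : ρ.Injective) (hQ : SimulatesOracle O ρ Q Ω base m) (hm : 1 ≤ m)
    (K : List Prog) (p : Prog) (L : List Prog) (s : Store) (a : α) :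
    ∃ k, 1 ≤ k ∧ k ≤ m ∧ steps O k (simConfig ρ Q base K ((p :: L, s), a)) =
      (sstep Ω ((p :: L, s), a)).map (simConfig ρ Q base K) := by
  cases p with
  | query q r =>
    refine ⟨m, hm, le_rfl, ?_⟩
    simp only [simConfig, List.map_cons, List.cons_append, Prog.embed, sstep]
    rw [hQ s a r, PMF.map_comp, PMF.map_comp]
    rfl
  | flip r =>
    refine ⟨1, le_rfl, hm, ?_⟩
    simp only [simConfig, List.map_cons, List.cons_append, Prog.embed, sstep, step]
    rw [yields_flip, PMF.map_comp, PMF.map_comp, PMF.map_comp]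
    congr 1
    funext b
    simp [simConfig, place_update hρ, place_apply hρ]
  | branch r pn pf pt =>
    refine ⟨1, le_rfl, hm, ?_⟩
    rw [show (1 : ℕ) = 0 + 1 from rfl, steps_succ]
    simp only [simConfig, List.map_cons, List.cons_append, Prog.embed, sstep, step, PMF.pure_map,
      PMF.pure_bind, steps_zero, place_apply hρ]
    rcases s r with _ | ⟨_ | _, l⟩ <;> rfl
  | loop r p =>
    refine ⟨1, le_rfl, hm, ?_⟩
    rw [show (1 : ℕ) = 0 + 1 from rfl, steps_succ]
    simp only [simConfig, List.map_cons, List.cons_append, Prog.embed, sstep, step, PMF.pure_map,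
      PMF.pure_bind, steps_zero, place_apply hρ]
    rcases s r with _ | ⟨_ | _, l⟩ <;> rfl
  | _ =>
    refine ⟨1, le_rfl, hm, ?_⟩
    rw [show (1 : ℕ) = 0 + 1 from rfl, steps_succ]
    simp [simConfig, Prog.embed, sstep, step, PMF.pure_map,
      PMF.pure_bind, steps_zero, place_apply hρ, place_update hρ]

/-- The contribution of a configuration of the simulated machine to the acceptance probability of
the simulating program: if the machine has halted, then the program goes on with `K`. -/
noncomputable def haltedProb (O : Oracle) (ρ : ℕ → ℕ) (base : α → Store) (K : List Prog) (t : ℕ)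
    (x : Config × α) : ℝ≥0∞ :=
  if x.1.1 = [] then acceptProb O t (K, place ρ x.1.2 (base x.2)) else 0

/-- Lower bound for the acceptance probability of a program that begins with a simulation: within
`m * t + t'` steps it can simulate `t` steps, and spend `t'` steps on what follows. -/
lemma expect_haltedProb_le (hρ : ρ.Injective) (hQ : SimulatesOracle O ρ Q Ω base m) (hm : 1 ≤ m)
    (K : List Prog) (t t' : ℕ) (x : Config × α) :
    expect (ssteps Ω t x) (haltedProb O ρ base K t') ≤
      acceptProb O (m * t + t') (simConfig ρ Q base K x) := by
  induction t generalizing x with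
  | zero =>
    rcases x with ⟨⟨_ | ⟨p, L⟩, s⟩, a⟩
    · simp [ssteps, haltedProb, simConfig]
    · simp [ssteps, haltedProb]
  | succ t ih =>
    rcases x with ⟨⟨_ | ⟨p, L⟩, s⟩, a⟩
    · rw [ssteps_nil, expect_pure]
      exact acceptProb_mono O (Nat.le_add_left _ _) _
    · obtain ⟨k, hk, hkm, hsteps⟩ := exists_steps_simConfig hρ hQ hm K p L s a
      rw [ssteps, expect_bind]
      calc _ ≤ expect (sstep Ω ((p :: L, s), a))
            (fun y => acceptProb O (m * t + t') (simConfig ρ Q base K y)) :=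
            expect_mono fun y _ => ih y
        _ = acceptProb O (k + (m * t + t')) (simConfig ρ Q base K ((p :: L, s), a)) := by
            rw [acceptProb_add, hsteps, expect_map]
        _ ≤ _ := acceptProb_mono O (by rw [Nat.mul_succ]; omega) _

/-- Upper bound for the acceptance probability of a program that begins with a simulation. The
simulation never runs faster than the simulated machine, which thus need not be known to halt. -/
lemma acceptProb_simConfig_le (hρ : ρ.Injective) (hQ : SimulatesOracle O ρ Q Ω base m)
    (hm : 1 ≤ m) (K : List Prog) {t t' : ℕ} (ht : t ≤ t') (x : Config × α) :
    acceptProb O t (simConfig ρ Q base K x) ≤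
      expect (ssteps Ω t x) (haltedProb O ρ base K t') := by
  induction t generalizing x with
  | zero =>
    rcases x with ⟨⟨_ | ⟨p, L⟩, s⟩, a⟩
    · simpa [ssteps, haltedProb, simConfig] using acceptProb_mono O ht _
    · simp [ssteps, haltedProb, simConfig, acceptProb_zero_cons]
  | succ t ih =>
    rcases x with ⟨⟨_ | ⟨p, L⟩, s⟩, a⟩
    · rw [ssteps_nil, expect_pure]
      exact acceptProb_mono O ht _
    · obtain ⟨k, hk, hkm, hsteps⟩ := exists_steps_simConfig hρ hQ hm K p L s a
      rw [ssteps, expect_bind]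
      calc _ ≤ acceptProb O (k + t) (simConfig ρ Q base K ((p :: L, s), a)) :=
            acceptProb_mono O (by omega) _
        _ = expect (sstep Ω ((p :: L, s), a))
            (fun y => acceptProb O t (simConfig ρ Q base K y)) := by
            rw [acceptProb_add, hsteps, expect_map]
        _ ≤ _ := expect_mono fun y _ => ih (by omega) y

end simulation

/-! ### Elementary subroutines

The distinguisher runs three given programs on the registers whose numbers are congruent to `0`, `1`
and `2` modulo `4`, and has the following registers of its own:

* `3` and `7`: the number `n` in unary, and a place to keep it while it is counted down;
* `11`: the point at which the function is queried, or which is searched for among the samples;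
* `15`: the concatenation of all points that occurred in the sample;
* `19`: auxiliary register for the reversal of strings;
* `23`: the differences found by a comparison;
* `27`: not empty if a point has been found in the sample;
* `31`: the value of the function with which the generated sample is compared;
* `35`: always empty.
-/

section subroutines

variable {O : Oracle} {s : Store}

/-- Move the top bit of register `a` to register `b`, if there is one. -/
def Prog.move (a b : ℕ) : Prog :=
  .branch a .skip (.seq (.pop a) (.push b false)) (.seq (.pop a) (.push b true))

/-- Move all bits of register `a` to register `b`, which reverses their order. -/
def Prog.pour (a b : ℕ) : Prog := .loop a (.move a b)

/-- Empty register `a`. -/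
def Prog.clear (a : ℕ) : Prog := .loop a (.pop a)

lemma runs_move {a b : ℕ} (hab : a ≠ b) {x : Bool} {l : List Bool} (ha : s a = x :: l) :
    Runs O (.move a b) s 4 (Function.update (Function.update s a l) b (x :: s b)) := by
  cases x
  · refine (runs_branch_false ha ((runs_pop a).seq (runs_push b false))).congr rfl ?_
    simp [ha, hab.symm]
  · refine (runs_branch_true ha ((runs_pop a).seq (runs_push b true))).congr rfl ?_
    simp [ha, hab.symm]

lemma runs_pour {a b : ℕ} (hab : a ≠ b) {l : List Bool} (ha : s a = l) :
    Runs O (.pour a b) s (5 * l.length + 1)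
      (Function.update (Function.update s a []) b (l.reverse ++ s b)) := by
  induction l generalizing s with
  | nil =>
    refine (runs_loop_nil ha).congr rfl ?_
    funext i
    simp only [Function.update_apply]
    split_ifs <;> simp_all
  | cons x l ih =>
    refine (runs_loop_cons ha (runs_move hab ha) (ih ?_)).congr ?_ ?_
    · simp [hab]
    · simp only [List.length_cons]
      ring
    · funext i
      simp only [Function.update_apply]
      split_ifs <;> simp_all

lemma runs_clear {a : ℕ} {l : List Bool} (ha : s a = l) :
    Runs O (.clear a) s (2 * l.length + 1) (Function.update s a []) := by
  induction l generalizing s with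
  | nil =>
    refine (runs_loop_nil ha).congr rfl ?_
    simp [← ha]
  | cons x l ih =>
    refine (runs_loop_cons ha (runs_pop a) (ih ?_)).congr ?_ ?_
    · simp [ha]
    · simp only [List.length_cons]
      ring
    · simp

/-- Compare the top bits of the registers `a` and `b`; register `d` remains empty as long as no
difference has been found. -/
def Prog.compareBit (a b d : ℕ) : Prog :=
  .branch a .skip
    (.branch b (.push d true) .skip (.push d true))
    (.branch b (.push d true) (.push d true) .skip)

/-- Test whether the content of register `a` is a prefix of the content of register `b`. Register
`d` remains empty if it is. The content of `a` is moved to `j`, and as many bits of `b` are lost. -/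
def Prog.comparePrefix (a b d j : ℕ) : Prog :=
  .loop a (.seq (.compareBit a b d) (.seq (.move a j) (.pop b)))

/-- The content of register `d` after `Prog.comparePrefix`. -/
def differences : List Bool → List Bool → List Bool → List Bool
  | [], _, d => d
  | x :: l, l', d => differences l l'.tail (if l'.head? = some x then d else true :: d)

lemma differences_eq_nil (l l' d : List Bool) : differences l l' d = [] ↔ d = [] ∧ l <+: l' := by
  induction l generalizing l' d with
  | nil => simp [differences]
  | cons x l ih =>
    rw [differences, ih]
    rcases l' with _ | ⟨y, l'⟩
    · simp
    · by_cases h : y = x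
      · simp [h]
      · simp [h, Ne.symm h]

lemma length_differences_le (l l' d : List Bool) :
    (differences l l' d).length ≤ l.length + d.length := by
  induction l generalizing l' d with
  | nil => simp [differences]
  | cons x l ih =>
    rw [differences]
    refine (ih _ _).trans ?_
    split_ifs
    · simp
    · simp only [List.length_cons]
      omega

lemma runs_compareBit {a b d : ℕ} {x : Bool} {l : List Bool} (ha : s a = x :: l) :
    Runs O (.compareBit a b d) s 3
      (Function.update s d (if (s b).head? = some x then s d else true :: s d)) := by
  rcases hb : s b with _ | ⟨_ | _, l'⟩ <;> cases x
  · exact (runs_branch_false ha (runs_branch_nil hb (runs_push d true)))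
  · exact (runs_branch_true ha (runs_branch_nil hb (runs_push d true)))
  · refine (runs_branch_false ha (runs_branch_false hb runs_skip)).congr rfl ?_
    simp
  · exact (runs_branch_true ha (runs_branch_false hb (runs_push d true)))
  · exact (runs_branch_false ha (runs_branch_true hb (runs_push d true)))
  · refine (runs_branch_true ha (runs_branch_true hb runs_skip)).congr rfl ?_
    simp

lemma runs_comparePrefix {a b d j : ℕ} (hab : a ≠ b) (had : a ≠ d) (haj : a ≠ j) (hbd : b ≠ d)
    (hbj : b ≠ j) (hdj : d ≠ j) {l : List Bool} (ha : s a = l) :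
    Runs O (.comparePrefix a b d j) s (11 * l.length + 1)
      (Function.update (Function.update (Function.update (Function.update s a [])
        b ((s b).drop l.length)) d (differences l (s b) (s d))) j (l.reverse ++ s j)) := by
  induction l generalizing s with
  | nil =>
    refine (runs_loop_nil ha).congr rfl ?_
    funext i
    simp only [Function.update_apply]
    split_ifs <;> simp_all [differences]
  | cons x l ih =>
    refine (runs_loop_cons ha ((runs_compareBit ha).seq
      ((runs_move haj (x := x) (l := l) ?_).seq (runs_pop b))) (ih ?_)).congr ?_ ?_
    · simp [had, ha]
    · simp [hab, haj]
    · simp only [List.length_cons]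
      ring
    · funext i
      simp only [Function.update_apply]
      split_ifs <;> simp_all [differences]

/-! ### Simulation of the sample oracle -/

/-- `k` independent fair coins, the last one first. -/
noncomputable def coins : ℕ → PMF (List Bool)
  | 0 => PMF.pure []
  | k + 1 => (PMF.uniformOfFintype Bool).bind fun b => (coins k).map fun x => x ++ [b]

/-- The coins are tossed one after the other and pushed on a stack, whence they form a uniformly
random string. -/
lemma coins_eq (n : ℕ) : coins n = (PMF.uniformOfFintype (Bits n)).map List.ofFn := by
  induction n with
  | zero =>
    ext l
    simp [coins, PMF.map_apply, PMF.pure_apply]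
  | succ n ih =>
    -- The first coin is at the bottom of the stack, so it is the last entry of the string.
    have key : PMF.uniformOfFintype (Bits (n + 1)) = (PMF.uniformOfFintype Bool).bind fun b =>
        (PMF.uniformOfFintype (Bits n)).map fun x => (Fin.snoc x b : Bits (n + 1)) := by
      ext y
      rw [PMF.bind_apply, tsum_eq_single (y (Fin.last n)), PMF.map_apply,
        tsum_eq_single (Fin.init y)]
      · simp [ENNReal.mul_inv, pow_succ, mul_comm]
      · intro x hx
        rw [if_neg]
        intro h
        exact hx (by rw [h, Fin.init_snoc])
      · intro b hb
        rw [PMF.map_apply, ENNReal.tsum_eq_zero.2, mul_zero]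
        intro x
        rw [if_neg]
        intro h
        exact hb (by rw [h, Fin.snoc_last])
    rw [coins, key, PMF.map_bind]
    congr 1
    funext b
    rw [ih, PMF.map_comp, PMF.map_comp]
    congr 1
    funext x
    rw [Function.comp_apply, Function.comp_apply, List.ofFn_succ']
    simp only [Fin.snoc_castSucc, Fin.snoc_last, List.concat_eq_append]

/-- Push `n` coins on each of the registers `11` and `15`, where `n` is the length of register `3`,
which is moved to register `7`. -/
def Prog.tossCoins : Prog :=
  .loop 3 (.seq (.pop 3) (.seq (.push 7 true) (.seq (.flip 11)
    (.branch 11 .skip (.push 15 false) (.push 15 true)))))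

lemma yields_tossCoins {n : ℕ} (h : s 3 = unary n) : Yields O .tossCoins s (9 * n + 1)
    ((coins n).map fun x => Function.update (Function.update (Function.update (Function.update s
      3 []) 7 (unary n ++ s 7)) 11 (x ++ s 11)) 15 (x ++ s 15)) := by
  rw [Prog.tossCoins]
  induction n generalizing s with
  | zero =>
    have h0 : (coins 0).map (fun x => Function.update (Function.update (Function.update
        (Function.update s 3 []) 7 (unary 0 ++ s 7)) 11 (x ++ s 11)) 15 (x ++ s 15)) =
        PMF.pure s := ?_
    · rw [h0]
      exact (runs_loop_nil h).yields
    rw [coins, PMF.pure_map]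
    congr 1
    funext i
    simp only [Function.update_apply]
    split_ifs <;> simp_all [unary]
  | succ n ih =>
    have hbody : Yields O (.seq (.pop 3) (.seq (.push 7 true) (.seq (.flip 11)
        (.branch 11 .skip (.push 15 false) (.push 15 true))))) s 8
        ((PMF.uniformOfFintype Bool).map fun b => Function.update (Function.update (Function.update
          (Function.update s 3 (unary n)) 7 (true :: s 7)) 11 (b :: s 11)) 15 (b :: s 15)) := by
      have h1 := ((runs_pop (O := O) (s := s) 3).yields.seq (fun s' _ =>
        (runs_push (s := s') 7 true).yields.seq (fun s'' _ => (yields_flip (s := s'') 11).seq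
        (p' := .branch 11 .skip (.push 15 false) (.push 15 true)) (m' := 2)
        (ν := fun s => PMF.pure (Function.update s 15 ((s 11).head?.toList ++ s 15)))
        (fun u hu => ?_))))
      · convert h1 using 1
        simp only [PMF.pure_bind, PMF.bind_map]
        rw [← PMF.bind_pure_comp]
        congr 1
        funext b
        simp only [Function.comp]
        congr 1
        funext i
        simp only [Function.update_apply]
        split_ifs <;> simp_all [unary, List.replicate_succ]
      · rw [PMF.mem_support_map_iff] at hu
        obtain ⟨b, -, rfl⟩ := hu
        cases b
        · refine (Runs.congr (runs_branch_false (l := s'' 11) (by simp) (runs_push 15 false)) rfl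
            ?_).yields
          simp
        · refine (Runs.congr (runs_branch_true (l := s'' 11) (by simp) (runs_push 15 true)) rfl
            ?_).yields
          simp
    have h3 : s 3 = true :: unary n := h
    have h2 := yields_loop_cons h3 hbody (fun s' hs' => ih (s := s') ?_)
    · rw [show 9 * (n + 1) + 1 = 8 + (9 * n + 1) + 1 by ring]
      convert h2 using 1
      simp only [coins, PMF.map_bind, PMF.bind_map, PMF.map_comp]
      congr 1
      funext b
      simp only [Function.comp_def]
      congr 1
      funext x
      funext i
      simp only [Function.update_apply]
      split_ifs <;> simp_all [unary, List.replicate_succ']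
    · rw [PMF.mem_support_map_iff] at hs'
      obtain ⟨b, -, rfl⟩ := hs'
      rfl

/-- Simulation of a call of the oracle `SAMPLE`: draw a random string, query the value of the
function, put the concatenation of both on register `r`, and record the string in register `15`. -/
def Prog.sample (r : ℕ) : Prog :=
  .seq .tossCoins (.seq (.query 11 r) (.seq (.pour 7 3) (.seq (.pour 11 19) (.pour 19 r))))

lemma reverse_unary (n : ℕ) : (unary n).reverse = unary n := List.reverse_replicate

lemma MQ_ofFn {n : ℕ} (f : Bits n → ℕ) (x : Bits n) :
    MQ f (List.ofFn x) = PMF.pure (List.ofFn (bin n (f x))) := by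
  rw [MQ, dif_pos (List.length_ofFn)]
  congr 5
  funext i
  simp

lemma MQ_nil {n : ℕ} (hn : n ≠ 0) (f : Bits n → ℕ) : MQ f [] = PMF.pure [] := by
  rw [MQ, dif_neg]
  simpa using hn.symm

lemma yields_sample {n r : ℕ} (f : Bits n → ℕ) (h3 : s 3 = unary n) (h7 : s 7 = [])
    (h11 : s 11 = []) (h19 : s 19 = []) (hr : r % 4 = 1) :
    Yields (MQ f) (.sample r) s (24 * n + 9) ((PMF.uniformOfFintype (Bits n)).map fun x =>
      Function.update (Function.update s 15 (List.ofFn x ++ s 15)) r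
        (List.ofFn x ++ List.ofFn (bin n (f x)))) := by
  have hr3 : r ≠ 3 := by omega
  have hr7 : r ≠ 7 := by omega
  have hr11 : r ≠ 11 := by omega
  have hr15 : r ≠ 15 := by omega
  have hr19 : r ≠ 19 := by omega
  have hrun : ∀ x : Bits n, Runs (MQ f)
      (.seq (.query 11 r) (.seq (.pour 7 3) (.seq (.pour 11 19) (.pour 19 r))))
      (Function.update (Function.update (Function.update (Function.update s 3 []) 7 (unary n ++ s 7))
        11 (List.ofFn x ++ s 11)) 15 (List.ofFn x ++ s 15)) (15 * n + 7)
      (Function.update (Function.update s 15 (List.ofFn x ++ s 15)) r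
        (List.ofFn x ++ List.ofFn (bin n (f x)))) := by
    intro x
    refine ((runs_query (a := List.ofFn (bin n (f x))) ?_).seq
      ((runs_pour (by decide) (l := unary n) ?_).seq
      ((runs_pour (by decide) (l := List.ofFn x) ?_).seq
      (runs_pour hr19.symm (l := (List.ofFn x).reverse) ?_)))).congr ?_ ?_
    · simp [h11, MQ_ofFn]
    · simp [hr7.symm, h7]
    · simp [hr11.symm, h11]
    · simp [hr19.symm, h19]
    · simp [unary]
      ring
    · funext i
      simp only [Function.update_apply]
      split_ifs <;> simp_all [reverse_unary]
  have h := yields_tossCoins (O := MQ f) h3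
  rw [coins_eq, PMF.map_comp] at h
  rw [show 24 * n + 9 = 9 * n + 1 + (15 * n + 7) + 1 by ring]
  exact h.seq_runs hrun

/-! ### Verification of a generated sample -/

/-- Move a unary number from register `0` to each of the registers `1`, `2`, `3`. -/
def Prog.copyUnary : Prog :=
  .loop 0 (.seq (.pop 0) (.seq (.push 1 true) (.seq (.push 2 true) (.push 3 true))))

lemma runs_copyUnary {n : ℕ} (h : s 0 = unary n) : Runs O .copyUnary s (8 * n + 1)
    (Function.update (Function.update (Function.update (Function.update s 0 []) 1 (unary n ++ s 1))
      2 (unary n ++ s 2)) 3 (unary n ++ s 3)) := by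
  induction n generalizing s with
  | zero =>
    refine (runs_loop_nil h).congr rfl ?_
    funext i
    simp only [Function.update_apply]
    split_ifs <;> simp_all [unary]
  | succ n ih =>
    refine (runs_loop_cons (l := unary n) h ((runs_pop 0).seq ((runs_push 1 true).seq
      ((runs_push 2 true).seq (runs_push 3 true)))) (ih ?_)).congr (by ring) ?_
    · simp [h, unary, List.replicate_succ]
    · funext i
      simp only [Function.update_apply]
      clear ih
      split_ifs <;> simp [h, unary, List.replicate_succ'] at *

/-- Move the first `n` bits of register `2` to register `19`, where `n` is the length of
register `3`. If register `2` is too short, then it is padded with zeros. -/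
def Prog.split : Prog :=
  .loop 3 (.seq (.pop 3) (.seq (.branch 2 (.push 2 false) .skip .skip) (.move 2 19)))

lemma runs_split {n : ℕ} (h : s 3 = unary n) : Runs O .split s (10 * n + 1)
    (Function.update (Function.update (Function.update s 3 []) 2 ((s 2).drop n)) 19
      (((s 2).takeD n false).reverse ++ s 19)) := by
  induction n generalizing s with
  | zero =>
    refine (runs_loop_nil h).congr rfl ?_
    funext i
    simp only [Function.update_apply]
    split_ifs <;> simp_all [unary]
  | succ n ih =>
    have hpad : ∀ u : Store, Runs O (.branch 2 (.push 2 false) .skip .skip) u 2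
        (Function.update u 2 ((u 2).head?.getD false :: (u 2).tail)) := by
      intro u
      rcases hu : u 2 with _ | ⟨_ | _, l⟩
      · refine (runs_branch_nil hu (runs_push 2 false)).congr rfl ?_
        simp [hu]
      · refine (runs_branch_false hu runs_skip).congr rfl ?_
        simp [hu]
      · refine (runs_branch_true hu runs_skip).congr rfl ?_
        simp [hu]
    refine (runs_loop_cons (l := unary n) h ((runs_pop 3).seq ((hpad _).seq
      (runs_move (by decide) (x := (s 2).head?.getD false) (l := (s 2).tail) ?_)))
      (ih ?_)).congr (by ring) ?_
    · simp
    · simp [h, unary, List.replicate_succ]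
    · funext i
      simp only [Function.update_apply]
      clear ih hpad
      split_ifs <;> simp [List.takeD_succ] at *

/-- Test whether the string in register `11` is among the strings recorded in register `15`, all of
which have the length of this string. Register `27` remains empty if it is not. -/
def Prog.findSample : Prog :=
  .loop 15 (.seq (.comparePrefix 11 15 23 19) (.seq (.branch 23 (.push 27 true) .skip .skip)
    (.seq (.clear 23) (.pour 19 11))))

lemma exists_runs_findSample {n : ℕ} (hn : n ≠ 0) {x : List Bool} {σ : List (List Bool)}
    (hx : x.length = n) (hσ : ∀ y ∈ σ, y.length = n) (h11 : s 11 = x) (h15 : s 15 = σ.flatten)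
    (h19 : s 19 = []) (h23 : s 23 = []) :
    ∃ m ≤ (18 * n + 9) * σ.length + 1, ∃ l, (l = [] ↔ s 27 = [] ∧ x ∉ σ) ∧
      Runs O .findSample s m (Function.update (Function.update s 15 []) 27 l) := by
  induction σ generalizing s with
  | nil =>
    refine ⟨1, by omega, s 27, by simp, (runs_loop_nil h15).congr rfl ?_⟩
    funext i
    simp only [Function.update_apply]
    split_ifs <;> simp_all
  | cons y σ ih =>
    have hy : y.length = n := hσ y (by simp)
    have hdrop : (s 15).drop n = σ.flatten := by
      rw [h15, List.flatten_cons, ← hy, List.drop_left]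
    -- Both strings have length `n`, so that `x` is a prefix of the record only if it is its first
    -- entry.
    have hpre : x <+: s 15 ↔ x = y := by
      rw [h15, List.flatten_cons]
      constructor
      · intro h
        exact (List.prefix_of_prefix_length_le h (List.prefix_append y _) (by omega)).eq_of_length
          (by omega)
      · rintro rfl
        exact List.prefix_append _ _
    have hD := differences_eq_nil x (s 15) []
    have hlen := length_differences_le x (s 15) []
    set D := differences x (s 15) [] with hDdef
    have hflag : ∀ u : Store, u 23 = D → Runs O (.branch 23 (.push 27 true) .skip .skip) u 2
        (Function.update u 27 (if D = [] then true :: u 27 else u 27)) := by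
      intro u hu
      rcases hDu : D with _ | ⟨_ | _, l⟩
      · exact (runs_branch_nil (hu.trans hDu) (runs_push 27 true)).congr rfl (by simp)
      · exact (runs_branch_false (hu.trans hDu) runs_skip).congr rfl (by simp)
      · exact (runs_branch_true (hu.trans hDu) runs_skip).congr rfl (by simp)
    obtain ⟨b, l, hbl⟩ : ∃ b l, s 15 = b :: l := by
      rw [← List.ne_nil_iff_exists_cons, h15]
      intro h
      simp only [List.flatten_cons, List.append_eq_nil_iff] at h
      simp [h.1] at hy
      omega
    have hbody : Runs O (.seq (.comparePrefix 11 15 23 19) (.seq (.branch 23 (.push 27 true)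
        .skip .skip) (.seq (.clear 23) (.pour 19 11)))) s
        (11 * x.length + 1 + (2 + (2 * D.length + 1 + (5 * x.reverse.length + 1) + 1) + 1) + 1)
        (Function.update (Function.update s 15 σ.flatten) 27
          (if D = [] then true :: s 27 else s 27)) := by
      refine ((runs_comparePrefix (by decide) (by decide) (by decide) (by decide) (by decide)
        (by decide) h11).seq ((hflag _ ?_).seq ((runs_clear (l := D) ?_).seq
        (runs_pour (l := x.reverse) (by decide) ?_)))).congr rfl ?_
      · simp [h23, hDdef]
      · simp [h23, hDdef]
      · simp [h19]
      · have hx15 : (s 15).drop x.length = σ.flatten := by rw [hx, hdrop]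
        funext i
        by_cases hi11 : i = 11
        · subst hi11
          simp [h11]
        by_cases hi15 : i = 15
        · subst hi15
          simp [hx15]
        by_cases hi19 : i = 19
        · subst hi19
          simp [h19]
        by_cases hi23 : i = 23
        · subst hi23
          simp [h23]
        by_cases hi27 : i = 27
        · subst hi27
          simp
        simp [hi11, hi15, hi19, hi23, hi27]
    obtain ⟨m, hm, l', hl', hrun⟩ := ih (s := Function.update (Function.update s 15 σ.flatten) 27
      (if D = [] then true :: s 27 else s 27)) (fun z hz => hσ z (by simp [hz])) (by simp [h11])
      (by simp) (by simp [h19]) (by simp [h23])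
    refine ⟨_, ?_, l', ?_, (runs_loop_cons hbl hbody hrun).congr rfl ?_⟩
    · rw [List.length_reverse, List.length_cons, Nat.mul_succ]
      simp only [List.length_nil] at hlen
      omega
    · rw [hl']
      simp only [Function.update_self, List.mem_cons, not_or]
      by_cases hxy : x = y
      · have : D = [] := hD.2 ⟨rfl, hpre.2 hxy⟩
        simp [this, hxy]
      · have : D ≠ [] := fun h => hxy (hpre.1 (hD.1 h).2)
        simp [this, hxy]
    · rw [Function.update_comm (by decide), Function.update_idem, Function.update_comm (by decide),
        Function.update_idem]

/-- The first `n` bits of a string, padded with zeros if the string is too short. -/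
def firstBits (n : ℕ) (z : List Bool) : Bits n := fun i => z.getD i false

lemma getElem_takeD (n : ℕ) (z : List Bool) (i : ℕ) (h : i < (z.takeD n false).length) :
    (z.takeD n false)[i] = z.getD i false := by
  induction n generalizing z i with
  | zero => simp at h
  | succ n ih =>
    rcases i with _ | i
    · cases z <;> simp
    · cases z <;> simp [ih]

lemma takeD_eq_ofFn (n : ℕ) (z : List Bool) : z.takeD n false = List.ofFn (firstBits n z) := by
  apply List.ext_getElem
  · simp
  · intro i h1 h2
    simp [firstBits, getElem_takeD]

/-- The string `z` is of the form `x || f x || ...`, where `x` does not belong to the list `σ`. What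
comes after the first `2 * n` bits is not tested, since it is absent in a sample from a
distribution on `{0,1}^(2n)`. A string shorter than `n` is padded, and then fails the test of
`f x` if `n ≠ 0`. -/
def IsFreshSample {n : ℕ} (f : Bits n → ℕ) (σ : List (Bits n)) (z : List Bool) : Prop :=
  firstBits n z ∉ σ ∧ List.ofFn (bin n (f (firstBits n z))) <+: z.drop n

/-- Test whether the string `z` in register `2` is of the form `x || f x || ...` with a string `x`
that is not among those recorded in register `15`, and store the result in register `0`. -/
def Prog.verify : Prog :=
  .seq .split (.seq (.pour 19 11) (.seq (.query 11 31) (.seq .findSample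
    (.seq (.comparePrefix 31 2 23 19)
      (.branch 23 (.branch 27 (.push 0 true) .skip .skip) .skip .skip)))))

/-- The contents of the registers in which the strings `σ` of the previous samples are recorded. -/
def record {n : ℕ} (σ : List (Bits n)) : List Bool := (σ.map List.ofFn).flatten

lemma exists_runs_verify {n : ℕ} (hn : n ≠ 0) (f : Bits n → ℕ) (σ : List (Bits n))
    (h0 : s 0 = []) (h3 : s 3 = unary n) (h11 : s 11 = []) (h15 : s 15 = record σ)
    (h19 : s 19 = []) (h23 : s 23 = []) (h27 : s 27 = []) :
    ∃ m ≤ (18 * n + 9) * σ.length + 26 * n + 20, ∃ s' : Store,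
      (s' 0 = [true] ↔ IsFreshSample f σ (s 2)) ∧ Runs (MQ f) .verify s m s' := by
  set x := firstBits n (s 2) with hx
  set u : Store := Function.update (Function.update (Function.update (Function.update s 3 [])
    2 ((s 2).drop n)) 11 (List.ofFn x)) 31 (List.ofFn (bin n (f x))) with hu
  have h1 : Runs (MQ f) .split s (10 * n + 1) (Function.update (Function.update (Function.update s
      3 []) 2 ((s 2).drop n)) 19 ((List.ofFn x).reverse)) := by
    refine (runs_split h3).congr rfl ?_
    rw [takeD_eq_ofFn, h19, List.append_nil]
  have h2 : Runs (MQ f) (.pour 19 11) (Function.update (Function.update (Function.update s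
      3 []) 2 ((s 2).drop n)) 19 ((List.ofFn x).reverse)) (5 * n + 1)
      (Function.update (Function.update (Function.update s 3 []) 2 ((s 2).drop n)) 11
        (List.ofFn x)) := by
    refine (runs_pour (by decide) (l := (List.ofFn x).reverse) (by simp)).congr (by simp) ?_
    funext i
    simp only [Function.update_apply]
    split_ifs <;> simp_all
  have h3 : Runs (MQ f) (.query 11 31) (Function.update (Function.update (Function.update s 3 [])
      2 ((s 2).drop n)) 11 (List.ofFn x)) 1 u := runs_query (by simp [MQ_ofFn])
  obtain ⟨m, hm, l, hl, h4⟩ := exists_runs_findSample (O := MQ f) (s := u) hn (x := List.ofFn x)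
    (σ := σ.map List.ofFn) (by simp) (by simp) (by simp [hu]) (by simpa [hu, record] using h15)
    (by simp [hu, h19]) (by simp [hu, h23])
  set D := differences (List.ofFn (bin n (f x))) ((s 2).drop n) [] with hDdef
  have hD := differences_eq_nil (List.ofFn (bin n (f x))) ((s 2).drop n) []
  rw [← hDdef] at hD
  have h5 := runs_comparePrefix (O := MQ f) (s := Function.update (Function.update u 15 []) 27 l)
    (a := 31) (b := 2) (d := 23) (j := 19) (by decide) (by decide)
    (by decide) (by decide) (by decide) (by decide) (l := List.ofFn (bin n (f x))) (by simp [hu])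
  set v := Function.update (Function.update (Function.update (Function.update (Function.update
    (Function.update u 15 []) 27 l) 31 []) 2 (List.drop (List.ofFn (bin n (f x))).length
    (Function.update (Function.update u 15 []) 27 l 2))) 23
    (differences (List.ofFn (bin n (f x))) (Function.update (Function.update u 15 []) 27 l 2)
      (Function.update (Function.update u 15 []) 27 l 23))) 19
    ((List.ofFn (bin n (f x))).reverse ++ Function.update (Function.update u 15 []) 27 l 19) with hv
  have hv23 : v 23 = D := by simp [hv, hu, hDdef, h23]
  have hv27 : v 27 = l := by simp [hv]
  have hv0 : v 0 = [] := by simp [hv, hu, h0]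
  have hl' : l = [] ↔ x ∉ σ := by
    rw [hl]
    simp [hu, h27, List.ofFn_injective.eq_iff]
  have h6 : ∃ m' ≤ 3, ∃ s' : Store, (s' 0 = [true] ↔ D = [] ∧ l = []) ∧
      Runs (MQ f) (.branch 23 (.branch 27 (.push 0 true) .skip .skip) .skip .skip) v m' s' := by
    rcases hDe : D with _ | ⟨_ | _, d⟩
    · rcases hle : l with _ | ⟨_ | _, l⟩
      · exact ⟨3, le_rfl, _, by simp [hv0], runs_branch_nil (hv23.trans hDe)
          (runs_branch_nil (hv27.trans hle) (runs_push 0 true))⟩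
      · exact ⟨3, le_rfl, _, by simp [hv0], runs_branch_nil (hv23.trans hDe)
          (runs_branch_false (hv27.trans hle) runs_skip)⟩
      · exact ⟨3, le_rfl, _, by simp [hv0], runs_branch_nil (hv23.trans hDe)
          (runs_branch_true (hv27.trans hle) runs_skip)⟩
    · exact ⟨2, by omega, _, by simp [hv0], runs_branch_false (hv23.trans hDe) runs_skip⟩
    · exact ⟨2, by omega, _, by simp [hv0], runs_branch_true (hv23.trans hDe) runs_skip⟩
  obtain ⟨m', hm', s', hs', h6⟩ := h6
  refine ⟨_, ?_, s', ?_, h1.seq (h2.seq (h3.seq (h4.seq (h5.seq h6))))⟩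
  · simp only [List.length_map, List.length_ofFn] at hm ⊢
    omega
  · rw [hs', hD, hl', IsFreshSample, ← hx]
    simp [and_comm]

end subroutines

/-! ### The distinguisher -/

section distinguisher

/-- The register `r` of the program that recovers `n`, in the distinguisher. -/
def recoverReg (r : ℕ) : ℕ := 4 * r

/-- The register `r` of the learner, in the distinguisher. -/
def learnReg (r : ℕ) : ℕ := 4 * r + 1

/-- The register `r` of the generator, in the distinguisher. The register that holds the description
of the generator is the one in which the learner leaves its output. -/
def genReg (r : ℕ) : ℕ := if r = 1 then 1 else 4 * r + 2

lemma recoverReg_injective : recoverReg.Injective := fun a b h => by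
  simp only [recoverReg] at h
  omega

lemma learnReg_injective : learnReg.Injective := fun a b h => by
  simp only [learnReg] at h
  omega

lemma genReg_injective : genReg.Injective := fun a b h => by
  simp only [genReg] at h
  split_ifs at h <;> omega

/-- A call of the oracle of an algorithm that has none. Register `35` is always empty, and the
membership query oracle returns the empty string on the empty query. -/
def Prog.noQuery (ρ : ℕ → ℕ) (r : ℕ) : Prog := .query 35 (ρ r)

/-- The distinguisher, built from the program `M` that recovers `n`, the learner `L` and the program
`G` that runs generators. -/
def Prog.distinguisher (M L G : Prog) : Prog :=
  .seq (M.embed recoverReg (.noQuery recoverReg)) (.seq .copyUnary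
    (.seq (L.embed learnReg fun r => .sample (learnReg r))
      (.seq (G.embed genReg (.noQuery genReg)) .verify)))

/-- `noOracle` as a stateful oracle. -/
noncomputable def noOracleStateful : StatefulOracle Unit := fun _ => PMF.pure ([], ())

/-- The oracle that returns samples of `x || f x` for uniform `x` and records the strings `x`. -/
noncomputable def recordingSample {n : ℕ} (f : Bits n → ℕ) : StatefulOracle (List (Bits n)) :=
  fun σ => (PMF.uniformOfFintype (Bits n)).map fun x =>
    (List.ofFn x ++ List.ofFn (bin n (f x)), x :: σ)

variable {n : ℕ}

lemma simulatesOracle_noQuery (hn : n ≠ 0) (f : Bits n → ℕ) {ρ : ℕ → ℕ} (hρ : ρ.Injective)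
    (h35 : ¬ ∃ r, ρ r = 35) {b : Store} (hb : b 35 = []) :
    SimulatesOracle (MQ f) ρ (.noQuery ρ) noOracleStateful (fun _ => b) 1 := by
  intro s a r
  rw [noOracleStateful, PMF.pure_map, place_update hρ]
  refine (runs_query ?_).yields
  rw [place_of_notMem _ _ h35]
  exact (congrArg (MQ f) hb).trans (MQ_nil hn f)

lemma simulatesOracle_sample (f : Bits n → ℕ) {b : Store} (h3 : b 3 = unary n) (h7 : b 7 = [])
    (h11 : b 11 = []) (h19 : b 19 = []) :
    SimulatesOracle (MQ f) learnReg (fun r => .sample (learnReg r)) (recordingSample f)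
      (fun σ => Function.update b 15 (record σ)) (24 * n + 9) := by
  intro s σ r
  have hmem : ∀ i, i % 4 ≠ 1 → ¬ ∃ r, learnReg r = i := by
    rintro i hi ⟨r, rfl⟩
    simp only [learnReg] at hi
    omega
  have h := yields_sample (s := place learnReg s (Function.update b 15 (record σ)))
    (r := learnReg r) f
    (by rw [place_of_notMem _ _ (hmem 3 (by decide))]; simpa using h3)
    (by rw [place_of_notMem _ _ (hmem 7 (by decide))]; simpa using h7)
    (by rw [place_of_notMem _ _ (hmem 11 (by decide))]; simpa using h11)
    (by rw [place_of_notMem _ _ (hmem 19 (by decide))]; simpa using h19)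
    (by simp only [learnReg]; omega)
  convert h using 1
  rw [recordingSample, PMF.map_comp]
  congr 1
  funext x
  simp only [Function.comp]
  rw [place_update learnReg_injective]
  congr 1
  funext i
  by_cases hi : ∃ r, learnReg r = i
  · obtain ⟨r', rfl⟩ := hi
    rw [place_apply learnReg_injective, Function.update_of_ne, place_apply learnReg_injective]
    simp only [learnReg]
    omega
  · rw [place_of_notMem _ _ hi]
    by_cases hi15 : i = 15
    · subst hi15
      rw [Function.update_self, Function.update_self, place_of_notMem _ _ hi, Function.update_self]
      simp [record]
    · rw [Function.update_of_ne hi15, Function.update_of_ne hi15, place_of_notMem _ _ hi,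
        Function.update_of_ne hi15]

lemma acceptProb_seq (O : Oracle) (t : ℕ) (p p' : Prog) (K : List Prog) (s : Store) :
    acceptProb O (1 + t) (.seq p p' :: K, s) = acceptProb O t (p :: p' :: K, s) := by
  rw [acceptProb, Nat.add_comm, steps_succ_of_step (c' := (p :: p' :: K, s)) rfl, acceptProb]

lemma acceptProb_seq_le (O : Oracle) (t : ℕ) (p p' : Prog) (K : List Prog) (s : Store) :
    acceptProb O t (.seq p p' :: K, s) ≤ acceptProb O t (p :: p' :: K, s) :=
  (acceptProb_mono O (Nat.le_add_left t 1) _).trans_eq (acceptProb_seq O t p p' K s)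

open Classical in
/-- The probability that the generator with description `h` produces, within `t` steps, a sample
that is consistent with `f` and that has not occurred in `σ`. -/
noncomputable def freshProb (G : Prog) (f : Bits n → ℕ) (t : ℕ) (h : List Bool)
    (σ : List (Bits n)) : ℝ≥0∞ :=
  expect (steps noOracle t ([G], initStore [unary n, h])) fun c =>
    if c.1 = [] ∧ IsFreshSample f σ (c.2 0) then 1 else 0

/-- The probability that the learner `L`, from samples of `x || f x`, produces within `t` steps the
description of a generator which then produces, within `t'` steps, a sample that is consistent with
`f` and that the learner has not seen. -/
noncomputable def learnProb (L G : Prog) (f : Bits n → ℕ) (t t' : ℕ) : ℝ≥0∞ :=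
  expect (ssteps (recordingSample f) t (([L], initStore [unary n]), [])) fun x =>
    if x.1.1 = [] then freshProb G f t' (x.1.2 0) x.2 else 0

lemma ssteps_noOracle (t : ℕ) (c : Config) :
    (ssteps noOracleStateful t (c, ())).map Prod.fst = steps noOracle t c := by
  rw [ssteps_map_fst (O := noOracle)]
  intro a q
  rw [noOracleStateful, PMF.pure_map]
  rfl

/-- In `t` steps the learner sees at most `t` samples. -/
lemma length_le_of_mem_support (f : Bits n → ℕ) (t : ℕ) (x : Config × List (Bits n))
    {y : Config × List (Bits n)} (hy : y ∈ (ssteps (recordingSample f) t x).support) :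
    y.2.length ≤ x.2.length + t := by
  induction t generalizing x with
  | zero =>
    rw [ssteps, PMF.mem_support_pure_iff] at hy
    rw [hy]
    omega
  | succ t ih =>
    rw [ssteps, PMF.mem_support_bind_iff] at hy
    obtain ⟨z, hz, hy⟩ := hy
    have h1 := ih z hy
    suffices z.2.length ≤ x.2.length + 1 by omega
    obtain ⟨c, σ⟩ := x
    unfold sstep at hz
    split at hz
    · rw [PMF.mem_support_map_iff] at hz
      obtain ⟨w, hw, rfl⟩ := hz
      rw [recordingSample, PMF.mem_support_map_iff] at hw
      obtain ⟨v, -, rfl⟩ := hw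
      simp_all
    · rw [PMF.mem_support_map_iff] at hz
      obtain ⟨w, hw, rfl⟩ := hz
      simp_all

/-- The requirements on the store in which the generator with description `h` is started, after the
points `σ` have been recorded. The learner may have left anything in its registers. -/
structure GenStart (n : ℕ) (h : List Bool) (σ : List (Bits n)) (b : Store) : Prop where
  zero : b 0 = []
  one : b 1 = h
  two : b 2 = unary n
  three : b 3 = unary n
  recorded : b 15 = record σ
  rest : ∀ i, 3 < i → i ≠ 15 → (i % 4 = 2 ∨ i % 4 = 3) → b i = []

lemma GenStart.eq_place {h : List Bool} {σ : List (Bits n)} {b : Store} (hb : GenStart n h σ b) :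
    b = place genReg (initStore [unary n, h]) b := by
  refine GeneratorLearning.eq_place genReg_injective fun r => ?_
  rcases r with _ | _ | r
  · simpa [genReg, initStore] using hb.two
  · simpa [genReg, initStore] using hb.one
  · rw [genReg, if_neg (by omega), hb.rest _ (by omega) (by omega) (by omega)]
    simp [initStore]

lemma notMem_genReg {i : ℕ} (h1 : i ≠ 1) (h2 : i % 4 ≠ 2) : ¬ ∃ r, genReg r = i := by
  rintro ⟨r, rfl⟩
  simp only [genReg] at h1 h2
  split_ifs at h1 h2 <;> omega

lemma GenStart.exists_runs_verify {h : List Bool} {σ : List (Bits n)} {b : Store}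
    (hb : GenStart n h σ b) (hn : n ≠ 0) (f : Bits n → ℕ) (s : Store) :
    ∃ m ≤ (18 * n + 9) * σ.length + 26 * n + 20, ∃ s' : Store,
      (s' 0 = [true] ↔ IsFreshSample f σ (s 0)) ∧
        Runs (MQ f) .verify (place genReg s b) m s' := by
  have h2 : place genReg s b 2 = s 0 := place_apply genReg_injective s b 0
  rw [← h2]
  apply GeneratorLearning.exists_runs_verify hn f σ
  · rw [place_of_notMem _ _ (notMem_genReg (by decide) (by decide)), hb.zero]
  · rw [place_of_notMem _ _ (notMem_genReg (by decide) (by decide)), hb.three]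
  · rw [place_of_notMem _ _ (notMem_genReg (by decide) (by decide)),
      hb.rest _ (by decide) (by decide) (by decide)]
  · rw [place_of_notMem _ _ (notMem_genReg (by decide) (by decide)), hb.recorded]
  · rw [place_of_notMem _ _ (notMem_genReg (by decide) (by decide)),
      hb.rest _ (by decide) (by decide) (by decide)]
  · rw [place_of_notMem _ _ (notMem_genReg (by decide) (by decide)),
      hb.rest _ (by decide) (by decide) (by decide)]
  · rw [place_of_notMem _ _ (notMem_genReg (by decide) (by decide)),
      hb.rest _ (by decide) (by decide) (by decide)]

lemma GenStart.simulates {h : List Bool} {σ : List (Bits n)} {b : Store}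
    (hb : GenStart n h σ b) (hn : n ≠ 0) (f : Bits n → ℕ) :
    SimulatesOracle (MQ f) genReg (.noQuery genReg) noOracleStateful (fun _ => b) 1 :=
  simulatesOracle_noQuery hn f genReg_injective (notMem_genReg (by decide) (by decide))
    (hb.rest _ (by decide) (by decide) (by decide))

lemma GenStart.acceptProb_le {h : List Bool} {σ : List (Bits n)} {b : Store}
    (hb : GenStart n h σ b) (hn : n ≠ 0) (f : Bits n → ℕ) (G : Prog) (t : ℕ) :
    acceptProb (MQ f) t ([G.embed genReg (.noQuery genReg), .verify], b) ≤
      freshProb G f t h σ := by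
  have := acceptProb_simConfig_le genReg_injective (hb.simulates hn f) le_rfl [.verify]
    (le_refl t) (([G], initStore [unary n, h]), ())
  simp only [simConfig, List.map_cons, List.map_nil, List.cons_append, List.nil_append,
    ← hb.eq_place] at this
  refine this.trans ?_
  rw [freshProb, ← ssteps_noOracle, expect_map]
  refine expect_mono fun x _ => ?_
  rw [haltedProb]
  obtain ⟨m, -, s', hs', hrun⟩ := hb.exists_runs_verify hn f x.1.2
  by_cases hx : x.1.1 = []
  · rw [if_pos hx]
    refine (hrun.acceptProb_le t []).trans ?_
    rw [acceptProb_nil]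
    by_cases hf : IsFreshSample f σ (x.1.2 0)
    · simp [hx, hf]
      split_ifs <;> simp
    · simp [hs', hf]
  · simp [hx]

lemma GenStart.le_acceptProb {h : List Bool} {σ : List (Bits n)} {b : Store}
    (hb : GenStart n h σ b) (hn : n ≠ 0) (f : Bits n → ℕ) (G : Prog) (t : ℕ) {T : ℕ}
    (hσ : σ.length ≤ T) :
    freshProb G f t h σ ≤ acceptProb (MQ f) (t + ((18 * n + 9) * T + 26 * n + 20))
      ([G.embed genReg (.noQuery genReg), .verify], b) := by
  have := expect_haltedProb_le genReg_injective (hb.simulates hn f) le_rfl [.verify]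
    t ((18 * n + 9) * T + 26 * n + 20) (([G], initStore [unary n, h]), ())
  simp only [simConfig, List.map_cons, List.map_nil, List.cons_append, List.nil_append,
    ← hb.eq_place, one_mul] at this
  refine le_trans ?_ this
  rw [freshProb, ← ssteps_noOracle, expect_map]
  refine expect_mono fun x _ => ?_
  rw [haltedProb]
  obtain ⟨m, hm, s', hs', hrun⟩ := hb.exists_runs_verify hn f x.1.2
  have hm' : m ≤ (18 * n + 9) * T + 26 * n + 20 :=
    hm.trans (by gcongr)
  obtain ⟨d, hd⟩ := Nat.exists_eq_add_of_le hm'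
  by_cases hx : x.1.1 = []
  · rw [if_pos hx, hd, hrun.acceptProb_add, acceptProb_nil]
    by_cases hf : IsFreshSample f σ (x.1.2 0)
    · simp [hx, hf, hs'.2 hf]
    · simp [hf]
  · simp [hx]

/-- The requirements on the store in which the learner is started. The program that recovers `n` may
have left anything in its registers, other than its output. -/
structure LearnStart (n : ℕ) (b : Store) : Prop where
  zero : b 0 = []
  one : b 1 = unary n
  two : b 2 = unary n
  three : b 3 = unary n
  rest : ∀ i, 3 < i → i % 4 ≠ 0 → b i = []

lemma LearnStart.eq_place {b : Store} (hb : LearnStart n b) :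
    b = place learnReg (initStore [unary n])
      (Function.update b 15 (record ([] : List (Bits n)))) := by
  have h15 : Function.update b 15 (record ([] : List (Bits n))) = b := by
    rw [Function.update_eq_self_iff, hb.rest _ (by decide) (by decide)]
    rfl
  rw [h15]
  refine GeneratorLearning.eq_place learnReg_injective fun r => ?_
  rcases r with _ | r
  · simpa [learnReg, initStore] using hb.one
  · rw [learnReg, hb.rest _ (by omega) (by omega)]
    simp [initStore]

lemma LearnStart.genStart {b : Store} (hb : LearnStart n b) (s : Store) (σ : List (Bits n)) :
    GenStart n (s 0) σ (place learnReg s (Function.update b 15 (record σ))) := by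
  have hmem : ∀ i, i % 4 ≠ 1 → ¬ ∃ r, learnReg r = i := by
    rintro i hi ⟨r, rfl⟩
    simp only [learnReg] at hi
    omega
  constructor
  · rw [place_of_notMem _ _ (hmem _ (by decide))]
    simpa using hb.zero
  · exact place_apply learnReg_injective s _ 0
  · rw [place_of_notMem _ _ (hmem _ (by decide))]
    simpa using hb.two
  · rw [place_of_notMem _ _ (hmem _ (by decide))]
    simpa using hb.three
  · rw [place_of_notMem _ _ (hmem _ (by decide))]
    simp
  · intro i hi hi' hi2
    rw [place_of_notMem _ _ (hmem _ (by omega)), Function.update_of_ne hi',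
      hb.rest i hi (by omega)]

lemma LearnStart.simulates {b : Store} (hb : LearnStart n b) (f : Bits n → ℕ) :
    SimulatesOracle (MQ f) learnReg (fun r => .sample (learnReg r)) (recordingSample f)
      (fun σ => Function.update b 15 (record σ)) (24 * n + 9) :=
  simulatesOracle_sample f hb.three (hb.rest _ (by decide) (by decide))
    (hb.rest _ (by decide) (by decide)) (hb.rest _ (by decide) (by decide))

lemma LearnStart.acceptProb_le {b : Store} (hb : LearnStart n b) (hn : n ≠ 0) (f : Bits n → ℕ)
    (L G : Prog) (t : ℕ) :
    acceptProb (MQ f) t ([L.embed learnReg fun r => .sample (learnReg r),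
      .seq (G.embed genReg (.noQuery genReg)) .verify], b) ≤ learnProb L G f t t := by
  have := acceptProb_simConfig_le learnReg_injective (hb.simulates f) (by omega)
    [.seq (G.embed genReg (.noQuery genReg)) .verify] (le_refl t)
    (([L], initStore [unary n]), [])
  simp only [simConfig, List.map_cons, List.map_nil, List.cons_append, List.nil_append,
    ← hb.eq_place] at this
  refine this.trans ?_
  rw [learnProb]
  refine expect_mono fun x _ => ?_
  rw [haltedProb]
  split_ifs with hx
  · exact (acceptProb_seq_le _ _ _ _ _ _).trans ((hb.genStart _ _).acceptProb_le hn f G t)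
  · exact le_rfl

lemma LearnStart.le_acceptProb {b : Store} (hb : LearnStart n b) (hn : n ≠ 0) (f : Bits n → ℕ)
    (L G : Prog) (T t : ℕ) :
    learnProb L G f T t ≤
      acceptProb (MQ f) ((24 * n + 9) * T + (1 + (t + ((18 * n + 9) * T + 26 * n + 20))))
        ([L.embed learnReg fun r => .sample (learnReg r),
          .seq (G.embed genReg (.noQuery genReg)) .verify], b) := by
  have := expect_haltedProb_le learnReg_injective (hb.simulates f) (by omega)
    [.seq (G.embed genReg (.noQuery genReg)) .verify] T
    (1 + (t + ((18 * n + 9) * T + 26 * n + 20))) (([L], initStore [unary n]), [])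
  simp only [simConfig, List.map_cons, List.map_nil, List.cons_append, List.nil_append,
    ← hb.eq_place] at this
  refine le_trans ?_ this
  rw [learnProb]
  refine expect_mono fun x hx => ?_
  have hlen := length_le_of_mem_support f T _ hx
  rw [haltedProb]
  split_ifs
  · rw [acceptProb_seq]
    exact (hb.genStart _ _).le_acceptProb hn f G t (by simpa using hlen)
  · exact le_rfl

lemma exists_of_mem_support_steps {M : Prog} {O : Oracle} {inputs : List (List Bool)} {t : ℕ}
    {o : List Bool} (h : M.law O inputs t = PMF.pure (some o)) {c : Config}
    (hc : c ∈ (steps O t ([M], initStore inputs)).support) : c.1 = [] ∧ c.2 0 = o := by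
  have : output c ∈ (M.law O inputs t).support := by
    rw [Prog.law, PMF.mem_support_map_iff]
    exact ⟨c, hc, rfl⟩
  rw [h, PMF.mem_support_pure_iff] at this
  rcases c with ⟨_ | ⟨p, K⟩, s⟩
  · simpa [output] using this
  · simp [output] at this

lemma law_eq_pure_of_le {M : Prog} {O : Oracle} {inputs : List (List Bool)} {t t' : ℕ}
    {o : List Bool} (h : M.law O inputs t = PMF.pure (some o)) (ht : t ≤ t') :
    M.law O inputs t' = PMF.pure (some o) := by
  obtain ⟨d, rfl⟩ := Nat.exists_eq_add_of_le ht
  rw [Prog.law, steps_add, PMF.map_bind]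
  rw [bind_congr_support (g := fun _ => PMF.pure (some o)), PMF.bind_const]
  intro c hc
  obtain ⟨h1, h2⟩ := exists_of_mem_support_steps h hc
  rcases c with ⟨K, s⟩
  subst h1 h2
  rw [steps_nil, PMF.pure_map, output]

section recovery

variable {M : Prog} {P : List Bool} {t : ℕ}

lemma initStore_eq_place (P : List Bool) :
    initStore [P] = place recoverReg (initStore [P]) fun _ => [] := by
  funext i
  by_cases hi : ∃ r, recoverReg r = i
  · obtain ⟨r, rfl⟩ := hi
    rw [place_apply recoverReg_injective]
    rcases r with _ | r
    · rfl
    · simp [recoverReg, initStore, mul_add]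
  · rw [place_of_notMem _ _ hi]
    rcases i with _ | i
    · exact absurd ⟨0, rfl⟩ hi
    · simp [initStore]

lemma notMem_recoverReg {i : ℕ} (h : i % 4 ≠ 0) : ¬ ∃ r, recoverReg r = i := by
  rintro ⟨r, rfl⟩
  simp only [recoverReg] at h
  omega

/-- After the recovery of `n`, and the distribution of copies of it, the learner can be started. -/
lemma exists_runs_copyUnary (O : Oracle) {s : Store} (h : s 0 = unary n) :
    ∃ b, LearnStart n b ∧
      Runs O .copyUnary (place recoverReg s fun _ => []) (8 * n + 1) b := by
  refine ⟨_, ?_, runs_copyUnary ((place_apply recoverReg_injective s _ 0).trans h)⟩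
  constructor
  · simp
  · simp [place_of_notMem s _ (notMem_recoverReg (i := 1) (by decide))]
  · simp [place_of_notMem s _ (notMem_recoverReg (i := 2) (by decide))]
  · simp [place_of_notMem s _ (notMem_recoverReg (i := 3) (by decide))]
  · intro i hi hi4
    rw [Function.update_of_ne (by omega), Function.update_of_ne (by omega),
      Function.update_of_ne (by omega), Function.update_of_ne (by omega),
      place_of_notMem _ _ (notMem_recoverReg hi4)]

lemma simulatesOracle_recover (hn : n ≠ 0) (f : Bits n → ℕ) :
    SimulatesOracle (MQ f) recoverReg (.noQuery recoverReg) noOracleStateful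
      (fun _ => fun _ => []) 1 :=
  simulatesOracle_noQuery hn f recoverReg_injective (notMem_recoverReg (by decide)) rfl

/-- The distinguisher, stopped after `t'` steps, is not better than the experiment in which the
learner and the generator are given `t'` steps each. -/
lemma law_distinguisher_le (hM : M.law noOracle [P] t = PMF.pure (some (unary n))) (hn : n ≠ 0)
    (f : Bits n → ℕ) (L G : Prog) {t' : ℕ} (ht : t ≤ t') :
    (Prog.distinguisher M L G).law (MQ f) [P] t' (some [true]) ≤ learnProb L G f t' t' := by
  rw [law_apply_true, Prog.distinguisher]
  refine (acceptProb_seq_le _ _ _ _ _ _).trans ?_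
  have := acceptProb_simConfig_le recoverReg_injective (simulatesOracle_recover hn f) le_rfl
    [.seq .copyUnary (.seq (L.embed learnReg fun r => .sample (learnReg r))
      (.seq (G.embed genReg (.noQuery genReg)) .verify))] (le_refl t')
    (([M], initStore [P]), ())
  simp only [simConfig, List.map_cons, List.map_nil, List.cons_append, List.nil_append,
    ← initStore_eq_place] at this
  refine this.trans (expect_le fun x hx => ?_)
  have hx' : x.1 ∈ (steps noOracle t' ([M], initStore [P])).support := by
    rw [← ssteps_noOracle, PMF.mem_support_map_iff]
    exact ⟨x, hx, rfl⟩
  obtain ⟨h1, h2⟩ := exists_of_mem_support_steps (law_eq_pure_of_le hM ht) hx'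
  obtain ⟨b, hb, hrun⟩ := exists_runs_copyUnary (MQ f) h2
  rw [haltedProb, if_pos h1]
  exact (acceptProb_seq_le _ _ _ _ _ _).trans ((hrun.acceptProb_le _ _).trans
    ((acceptProb_seq_le _ _ _ _ _ _).trans (hb.acceptProb_le hn f L G t')))

/-- With enough time, the distinguisher is at least as good as the experiment in which the learner
and the generator are given `T` and `t'` steps. -/
lemma le_law_distinguisher (hM : M.law noOracle [P] t = PMF.pure (some (unary n))) (hn : n ≠ 0)
    (f : Bits n → ℕ) (L G : Prog) {T t' u : ℕ}
    (hu : t + (42 * n + 18) * T + t' + 34 * n + 30 ≤ u) :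
    learnProb L G f T t' ≤ (Prog.distinguisher M L G).law (MQ f) [P] u (some [true]) := by
  rw [law_apply_true, Prog.distinguisher]
  set v := (24 * n + 9) * T + (1 + (t' + ((18 * n + 9) * T + 26 * n + 20))) with hv
  have hv' : v = (42 * n + 18) * T + t' + 26 * n + 21 := by
    rw [hv]
    ring
  refine le_trans ?_ (acceptProb_mono (MQ f) (t := 1 + (t + (1 + (8 * n + 1 + (1 + v)))))
    (by omega) _)
  rw [acceptProb_seq]
  have := expect_haltedProb_le recoverReg_injective (simulatesOracle_recover hn f) le_rfl
    [.seq .copyUnary (.seq (L.embed learnReg fun r => .sample (learnReg r))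
      (.seq (G.embed genReg (.noQuery genReg)) .verify))] t (1 + (8 * n + 1 + (1 + v)))
    (([M], initStore [P]), ())
  simp only [simConfig, List.map_cons, List.map_nil, List.cons_append, List.nil_append,
    ← initStore_eq_place, one_mul] at this
  refine le_trans (le_expect fun x hx => ?_) this
  have hx' : x.1 ∈ (steps noOracle t ([M], initStore [P])).support := by
    rw [← ssteps_noOracle, PMF.mem_support_map_iff]
    exact ⟨x, hx, rfl⟩
  obtain ⟨h1, h2⟩ := exists_of_mem_support_steps hM hx'
  obtain ⟨b, hb, hrun⟩ := exists_runs_copyUnary (MQ f) h2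
  rw [haltedProb, if_pos h1, acceptProb_seq, hrun.acceptProb_add, acceptProb_seq]
  exact hb.le_acceptProb hn f L G T t'

end recovery

end distinguisher

/-! ### Fresh samples of random functions -/

section fresh

lemma bin_injOn {n v v' : ℕ} (hv : v < 2 ^ n) (hv' : v' < 2 ^ n) (h : bin n v = bin n v') :
    v = v' := by
  refine Nat.eq_of_testBit_eq fun i => ?_
  by_cases hi : i < n
  · simpa [bin] using congrFun h (Fin.rev ⟨i, hi⟩)
  · have h2 : 2 ^ n ≤ 2 ^ i := Nat.pow_le_pow_right (by norm_num) (by omega)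
    rw [Nat.testBit_lt_two_pow (hv.trans_le h2), Nat.testBit_lt_two_pow (hv'.trans_le h2)]

variable {n : ℕ}

lemma subset_of_mem_support_sstep (f : Bits n → ℕ) {x y : Config × List (Bits n)}
    (hy : y ∈ (sstep (recordingSample f) x).support) : x.2 ⊆ y.2 := by
  obtain ⟨c, σ⟩ := x
  unfold sstep at hy
  split at hy
  · rw [PMF.mem_support_map_iff] at hy
    obtain ⟨w, hw, rfl⟩ := hy
    rw [recordingSample, PMF.mem_support_map_iff] at hw
    obtain ⟨v, -, rfl⟩ := hw
    simp_all
  · rw [PMF.mem_support_map_iff] at hy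
    obtain ⟨w, hw, rfl⟩ := hy
    simp_all

lemma subset_of_mem_support_ssteps (f : Bits n → ℕ) (t : ℕ) {x y : Config × List (Bits n)}
    (hy : y ∈ (ssteps (recordingSample f) t x).support) : x.2 ⊆ y.2 := by
  induction t generalizing x with
  | zero =>
    rw [ssteps, PMF.mem_support_pure_iff] at hy
    rw [hy]
    exact List.Subset.refl _
  | succ t ih =>
    rw [ssteps, PMF.mem_support_bind_iff] at hy
    obtain ⟨z, hz, hy⟩ := hy
    exact List.Subset.trans (subset_of_mem_support_sstep f hz) (ih hy)

lemma sstep_apply_eq_of_notMem {f f' : Bits n → ℕ} {x₀ : Bits n} (hf : ∀ x ≠ x₀, f x = f' x)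
    (x : Config × List (Bits n)) {y : Config × List (Bits n)} (hy : x₀ ∉ y.2) :
    sstep (recordingSample f) x y = sstep (recordingSample f') x y := by
  obtain ⟨c, σ⟩ := x
  unfold sstep
  split
  · simp only [recordingSample, PMF.map_comp]
    rw [PMF.map_apply, PMF.map_apply]
    refine tsum_congr fun v => ?_
    by_cases hv : v = x₀
    · subst hv
      rw [if_neg, if_neg]
      · rintro rfl
        simp at hy
      · rintro rfl
        simp at hy
    · have := hf v hv
      split_ifs with h1 h2 h2
      · rfl
      · exact absurd (by rwa [Function.comp_apply, this] at h1) h2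
      · exact absurd (by rwa [Function.comp_apply, ← this] at h2) h1
      · rfl
  · rfl

/-- The value of the function at a point has no influence on the runs in which this point does not
occur in the sample. -/
lemma ssteps_apply_eq_of_notMem {f f' : Bits n → ℕ} {x₀ : Bits n} (hf : ∀ x ≠ x₀, f x = f' x)
    (t : ℕ) (x : Config × List (Bits n)) {y : Config × List (Bits n)} (hy : x₀ ∉ y.2) :
    ssteps (recordingSample f) t x y = ssteps (recordingSample f') t x y := by
  induction t generalizing x with
  | zero => rfl
  | succ t ih =>
    rw [ssteps, ssteps, PMF.bind_apply, PMF.bind_apply]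
    refine tsum_congr fun z => ?_
    by_cases hz : x₀ ∈ z.2
    · have h0 : ∀ f : Bits n → ℕ, ssteps (recordingSample f) t z y = 0 := fun f =>
        (PMF.apply_eq_zero_iff _ _).2 fun h => hy (subset_of_mem_support_ssteps f t h hz)
      rw [h0, h0, mul_zero, mul_zero]
    · rw [sstep_apply_eq_of_notMem hf x hz, ih]

/-- Apply a permutation to the value of a function at the point `x₀`. -/
def permuteAt (x₀ : Bits n) (e : Equiv.Perm ℕ) : (Bits n → ℕ) ≃ (Bits n → ℕ) :=
  Equiv.piCongrRight fun x => if x = x₀ then e else Equiv.refl ℕ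

lemma permuteAt_self (x₀ : Bits n) (e : Equiv.Perm ℕ) (f : Bits n → ℕ) :
    permuteAt x₀ e f x₀ = e (f x₀) := by
  simp [permuteAt]

lemma permuteAt_of_ne {x₀ x : Bits n} (h : x ≠ x₀) (e : Equiv.Perm ℕ) (f : Bits n → ℕ) :
    permuteAt x₀ e f x = f x := by
  simp [permuteAt, h]

namespace KeyedFunctions

variable (C : KeyedFunctions) {P : List Bool}

lemma mem_support_randomFunction {R : Bits n → ℕ} :
    R ∈ (C.randomFunction n P).support ↔ ∀ x, R x ∈ C.cod P := by
  rw [randomFunction, PMF.mem_support_uniformOfFinset_iff, Fintype.mem_piFinset]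

lemma randomFunction_permuteAt {x₀ : Bits n} {e : Equiv.Perm ℕ}
    (he : ∀ v, e v ∈ C.cod P ↔ v ∈ C.cod P) (R : Bits n → ℕ) :
    C.randomFunction n P (permuteAt x₀ e R) = C.randomFunction n P R := by
  have h : permuteAt x₀ e R ∈ (Fintype.piFinset fun _ : Bits n => C.cod P) ↔
      R ∈ (Fintype.piFinset fun _ : Bits n => C.cod P) := by
    simp only [Fintype.mem_piFinset]
    refine forall_congr' fun x => ?_
    by_cases hx : x = x₀
    · rw [hx, permuteAt_self, he]
    · rw [permuteAt_of_ne hx]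
  rw [randomFunction, PMF.uniformOfFinset_apply, PMF.uniformOfFinset_apply]
  by_cases hR : R ∈ Fintype.piFinset fun _ : Bits n => C.cod P
  · rw [if_pos (h.2 hR), if_pos hR]
  · rw [if_neg (mt h.1 hR), if_neg hR]

/-- A weight that does not depend on the value of the random function `R` at `x₀` is halved, at
least, by the condition that this value is `v`. -/
lemma expect_randomFunction_value_le (hcod : 2 ≤ (C.cod P).card) (x₀ : Bits n)
    (w : (Bits n → ℕ) → ℝ≥0∞) (hw : ∀ R R', (∀ x ≠ x₀, R x = R' x) → w R = w R') (v : ℕ) :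
    expect (C.randomFunction n P) (fun R => if R x₀ = v then w R else 0) * 2 ≤
      expect (C.randomFunction n P) w := by
  by_cases hv : v ∈ C.cod P
  · -- Exchanging `v` with another value `v'` shows that both are equally likely.
    obtain ⟨v', hv', hne⟩ := Finset.exists_mem_ne hcod v
    have he : ∀ u, Equiv.swap v v' u ∈ C.cod P ↔ u ∈ C.cod P := by
      intro u
      rw [Equiv.swap_apply_def]
      split_ifs with h1 h2
      · simp [h1, hv, hv']
      · simp [h2, hv, hv']
      · rfl
    have hswap : expect (C.randomFunction n P) (fun R => if R x₀ = v then w R else 0) =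
        expect (C.randomFunction n P) (fun R => if R x₀ = v' then w R else 0) := by
      rw [expect, expect, ← (permuteAt x₀ (Equiv.swap v v')).tsum_eq]
      refine tsum_congr fun R => ?_
      rw [C.randomFunction_permuteAt he, permuteAt_self,
        hw _ R fun x hx => permuteAt_of_ne hx _ _]
      have : Equiv.swap v v' (R x₀) = v ↔ R x₀ = v' := by
        rw [Equiv.swap_apply_eq_iff, Equiv.swap_apply_left]
      simp only [this]
    rw [mul_two]
    nth_rewrite 2 [hswap]
    rw [expect, expect, ← ENNReal.tsum_add]
    refine ENNReal.tsum_le_tsum fun R => ?_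
    rw [← mul_add]
    gcongr
    by_cases h : R x₀ = v
    · rw [if_pos h, if_neg (by rw [h]; exact hne.symm), add_zero]
    · rw [if_neg h, zero_add]
      split_ifs <;> simp
  · have : expect (C.randomFunction n P) (fun R => if R x₀ = v then w R else 0) = 0 := by
      refine le_antisymm (expect_le fun R hR => ?_) zero_le
      rw [if_neg]
      rintro rfl
      exact hv (C.mem_support_randomFunction.1 hR x₀)
    rw [this, zero_mul]
    exact zero_le

open Classical in
/-- For a random function, a given string `z` is a fresh sample with probability at most `1 / 2`,
conditionally on the final configuration and sample `y` of the learner. -/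
lemma expect_isFreshSample_le (hP : ∀ y ∈ C.cod P, y < 2 ^ n) (hcod : 2 ≤ (C.cod P).card)
    (t : ℕ) (x y : Config × List (Bits n)) (z : List Bool) :
    expect (C.randomFunction n P) (fun R => ssteps (recordingSample R) t x y *
      if IsFreshSample R y.2 z then 1 else 0) * 2 ≤
    expect (C.randomFunction n P) (fun R => ssteps (recordingSample R) t x y) := by
  set x₀ := firstBits n z with hx₀
  by_cases hmem : x₀ ∈ y.2
  · simp [IsFreshSample, ← hx₀, hmem, expect]
  -- At most one value in the codomain is consistent with `z`.
  by_cases hex : ∃ v ∈ C.cod P, List.ofFn (bin n v) <+: z.drop n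
  · obtain ⟨v, hv, hvz⟩ := hex
    refine le_trans ?_ (C.expect_randomFunction_value_le hcod x₀ _
      (fun R R' h => ssteps_apply_eq_of_notMem h t x hmem) v)
    gcongr
    refine expect_mono fun R hR => ?_
    by_cases hf : IsFreshSample R y.2 z
    · have hR' := C.mem_support_randomFunction.1 hR x₀
      have : R x₀ = v := by
        refine bin_injOn (hP _ hR') (hP _ hv) (List.ofFn_injective ?_)
        exact (List.prefix_of_prefix_length_le hf.2 hvz (by simp)).eq_of_length (by simp)
      rw [if_pos hf, if_pos this, mul_one]
    · simp [hf]
  · have : expect (C.randomFunction n P) (fun R => ssteps (recordingSample R) t x y *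
        if IsFreshSample R y.2 z then 1 else 0) = 0 := by
      refine le_antisymm (expect_le fun R hR => ?_) zero_le
      rw [if_neg, mul_zero]
      exact fun hf => hex ⟨_, C.mem_support_randomFunction.1 hR x₀, hf.2⟩
    rw [this, zero_mul]
    exact zero_le

/-- No learner succeeds with probability more than `1 / 2` for a random function. The law of the
generated string `z` depends on the function only through the description `y.1.2 0` that the learner
outputs, so that it is enough to consider fixed `y` and `z`. -/
lemma expect_learnProb_le (hP : ∀ y ∈ C.cod P, y < 2 ^ n) (hcod : 2 ≤ (C.cod P).card)
    (L G : Prog) (t t' : ℕ) :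
    expect (C.randomFunction n P) (fun R => learnProb L G R t t') * 2 ≤ 1 := by
  classical
  set x : Config × List (Bits n) := (([L], initStore [unary n]), []) with hx
  set U := C.randomFunction n P
  have h1 : ∀ R : Bits n → ℕ, learnProb L G R t t' ≤
      ∑' y : Config × List (Bits n), expect (steps noOracle t' ([G], initStore [unary n, y.1.2 0]))
        fun c => ssteps (recordingSample R) t x y *
          if IsFreshSample R y.2 (c.2 0) then 1 else 0 := by
    intro R
    rw [learnProb, expect]
    refine ENNReal.tsum_le_tsum fun y => ?_
    split_ifs
    · simp only [freshProb, expect, ← ENNReal.tsum_mul_left]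
      refine ENNReal.tsum_le_tsum fun c => ?_
      rw [mul_left_comm]
      gcongr
      by_cases hf : IsFreshSample R y.2 (c.2 0)
      · simp only [hf, and_true, if_true]
        split_ifs <;> simp
      · simp [hf]
    · simp
  calc _ ≤ expect U (fun R => ∑' y : Config × List (Bits n),
        expect (steps noOracle t' ([G], initStore [unary n, y.1.2 0])) fun c =>
          ssteps (recordingSample R) t x y * if IsFreshSample R y.2 (c.2 0) then 1 else 0) * 2 := by
        gcongr
        exact expect_mono fun R _ => h1 R
    _ = ∑' y : Config × List (Bits n),
        expect (steps noOracle t' ([G], initStore [unary n, y.1.2 0])) fun c =>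
          expect U (fun R => ssteps (recordingSample R) t x y *
            if IsFreshSample R y.2 (c.2 0) then 1 else 0) * 2 := by
        simp only [expect_mul_right]
        rw [ENNReal.tsum_mul_right]
        congr 1
        rw [expect]
        simp only [← ENNReal.tsum_mul_left]
        rw [ENNReal.tsum_comm]
        refine tsum_congr fun y => ?_
        rw [← expect_comm]
        rfl
    _ ≤ ∑' y : Config × List (Bits n), expect U (fun R => ssteps (recordingSample R) t x y) :=
        ENNReal.tsum_le_tsum fun y => expect_le fun c _ =>
          C.expect_isFreshSample_le hP hcod t x y (c.2 0)
    _ = expect U (fun R => ∑' y, ssteps (recordingSample R) t x y) := by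
        simp only [expect, ← ENNReal.tsum_mul_left]
        exact ENNReal.tsum_comm
    _ = 1 := by simp only [PMF.tsum_coe, expect_const]

end KeyedFunctions

/-! ### Fresh samples of a good generator -/

/-- If `D` is uniform on the image of `g` and `dKL D D' ≤ ε`, then `D'` gives mass close to `1` to
this set without any small subset `B`. The constant `a` balances the two error terms. -/
lemma le_sum_of_dKL_le {ι : Type*} [Fintype ι] [DecidableEq ι] [Nonempty ι] {m : ℕ} {g : ι → Bits m}
    (hg : g.Injective) {D' : PMF (Bits m)} {ε : ℝ}
    (h : dKL ((PMF.uniformOfFintype ι).map g) D' ≤ (ε : EReal)) (B : Finset ι) {a : ℝ}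
    (ha : 0 < a) :
    1 - ε * Real.log 2 - 1 / a - Real.log a * (B.card / Fintype.card ι) ≤
      ∑ x ∈ Bᶜ, (D' (g x)).toReal := by
  classical
  set D := (PMF.uniformOfFintype ι).map g with hDdef
  set N : ℝ := (Fintype.card ι : ℝ) with hN
  have hNpos : 0 < N := by
    rw [hN]
    exact_mod_cast Fintype.card_pos
  set w : ι → ℝ := fun x => (D' (g x)).toReal with hw
  have hD : ∀ x, D (g x) = (Fintype.card ι : ℝ≥0∞)⁻¹ := by
    intro x
    rw [hDdef, PMF.map_apply, tsum_eq_single x]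
    · simp
    · intro y hy
      rw [if_neg]
      exact fun h => hy (hg h).symm
  have hD0 : ∀ y, y ∉ Set.range g → D y = 0 := by
    intro y hy
    rw [PMF.apply_eq_zero_iff, hDdef, PMF.mem_support_map_iff]
    rintro ⟨x, -, rfl⟩
    exact hy ⟨x, rfl⟩
  rw [dKL] at h
  split_ifs at h with habs
  swap
  · exact absurd h (not_le.2 (EReal.coe_lt_top ε))
  have hwpos : ∀ x, 0 < w x := by
    intro x
    refine ENNReal.toReal_pos (fun h0 => ?_) (D'.apply_ne_top _)
    have := habs _ h0
    rw [hD] at this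
    simp at this
  have hsum : ∑ y, (D y).toReal * Real.logb 2 ((D y).toReal / (D' y).toReal) =
      ∑ x, N⁻¹ * Real.logb 2 (N⁻¹ / w x) := by
    symm
    refine Finset.sum_of_injOn g hg.injOn (by simp) ?_ ?_
    · intro y _ hy
      rw [hD0 y (by simpa using hy)]
      simp
    · intro x _
      simp [hD, hN, hw]
  rw [hsum, EReal.coe_le_coe_iff] at h
  have hlog2 : 0 < Real.log 2 := Real.log_pos (by norm_num)
  have hterm : ∀ x, N⁻¹ * Real.logb 2 (N⁻¹ / w x) * Real.log 2 = -(N⁻¹ * Real.log (N * w x)) := by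
    intro x
    rw [mul_assoc, Real.logb, div_mul_cancel₀ _ hlog2.ne', ← mul_neg, ← Real.log_inv]
    congr 2
    rw [mul_inv, div_eq_mul_inv]
  have h1 : -(ε * Real.log 2) ≤ ∑ x, N⁻¹ * Real.log (N * w x) := by
    have := mul_le_mul_of_nonneg_right h hlog2.le
    rw [Finset.sum_mul, Finset.sum_congr rfl (fun x _ => hterm x), Finset.sum_neg_distrib] at this
    linarith
  -- The bound `log u ≤ u - 1` is used for `u = N * w x` outside of `B`, and for `u = N * w x / a`
  -- on `B`, where `N * w x` may be large: there the mass `w x` contributes only `w x / a`.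
  have h2 : ∀ x, N⁻¹ * Real.log (N * w x) ≤ w x - N⁻¹ := by
    intro x
    have := Real.log_le_sub_one_of_pos (mul_pos hNpos (hwpos x))
    calc _ ≤ N⁻¹ * (N * w x - 1) := by gcongr
      _ = _ := by field_simp
  have h3 : ∀ x, N⁻¹ * Real.log (N * w x) ≤ w x / a - N⁻¹ + Real.log a * N⁻¹ := by
    intro x
    have := Real.log_le_sub_one_of_pos (div_pos (mul_pos hNpos (hwpos x)) ha)
    rw [Real.log_div (mul_pos hNpos (hwpos x)).ne' ha.ne'] at this
    calc _ ≤ N⁻¹ * (N * w x / a - 1 + Real.log a) := by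
          gcongr
          linarith
      _ = _ := by field_simp
  have h4 : ∑ x ∈ B, w x ≤ 1 := by
    have h5 : ∑ x ∈ B, D' (g x) ≤ 1 := by
      rw [← Finset.sum_image (f := fun y => D' y) hg.injOn, ← D'.tsum_coe]
      exact ENNReal.sum_le_tsum _
    rw [hw]
    simp only
    rw [← ENNReal.toReal_sum fun x _ => D'.apply_ne_top _]
    exact ENNReal.toReal_mono ENNReal.one_ne_top h5
  have hcard : ((Bᶜ).card : ℝ) = N - B.card := by
    rw [Finset.card_compl, Nat.cast_sub (Finset.card_le_univ B)]
  have h6 : ∑ x, N⁻¹ * Real.log (N * w x) ≤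
      (∑ x ∈ Bᶜ, w x - (N - B.card) * N⁻¹) +
        ((∑ x ∈ B, w x) / a - B.card * N⁻¹ + B.card * (Real.log a * N⁻¹)) := by
    rw [← Finset.sum_compl_add_sum B]
    refine add_le_add ((Finset.sum_le_sum fun x _ => h2 x).trans_eq ?_)
      ((Finset.sum_le_sum fun x _ => h3 x).trans_eq ?_)
    · rw [Finset.sum_sub_distrib, Finset.sum_const, nsmul_eq_mul, hcard]
    · rw [Finset.sum_add_distrib, Finset.sum_sub_distrib, Finset.sum_const, Finset.sum_const,
        nsmul_eq_mul, nsmul_eq_mul, Finset.sum_div]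
  have h7 : (∑ x ∈ B, w x) / a ≤ 1 / a := by gcongr
  have h8 : (N - B.card) * N⁻¹ = 1 - B.card * N⁻¹ := by
    field_simp
  have h9 : Real.log a * (B.card / N) = B.card * (Real.log a * N⁻¹) := by
    rw [div_eq_mul_inv]
    ring
  rw [h9]
  linarith

lemma ofFn_append_bin (f : Bits n → ℕ) (x : Bits n) :
    List.ofFn (Fin.append x (bin n (f x))) = List.ofFn x ++ List.ofFn (bin n (f x)) :=
  List.ofFn_fin_append _ _

lemma isFreshSample_append {f : Bits n → ℕ} {σ : List (Bits n)} {x : Bits n} (hx : x ∉ σ) :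
    IsFreshSample f σ (List.ofFn (Fin.append x (bin n (f x)))) := by
  have hfirst : firstBits n (List.ofFn (Fin.append x (bin n (f x)))) = x := by
    funext i
    rw [ofFn_append_bin, firstBits, List.getD_append _ _ _ _ (by simp)]
    simp
  rw [IsFreshSample, hfirst, ofFn_append_bin, List.drop_left' (by simp)]
  exact ⟨hx, List.prefix_rfl⟩

lemma kgen_injective (C : KeyedFunctions) (P k : List Bool) : (C.kgen n P k).Injective :=
  fun x y h => by
    simpa [KeyedFunctions.kgen] using congrArg (fun z i => z (Fin.castAdd n i)) h

/-- The generator of a distribution close to that of `x || F_P(k,x)` is likely to produce a fresh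
sample. -/
lemma le_freshProb (C : KeyedFunctions) {P k : List Bool} {L : GeneratorLearner} {t : ℕ}
    {h : List Bool} {D' : PMF (Bits (n + n))} (hD' : L.Generates n t h D')
    (hd : dKL (C.kdist n P k) D' ≤ ((1 / 10 : ℝ) : EReal)) {σ : List (Bits n)}
    (hσ : (σ.length : ℝ) ≤ 2 ^ n / 100) :
    ENNReal.ofReal (7 / 10) ≤ freshProb L.gen (C.F n P k) t h σ := by
  classical
  have h1 : ∑ x ∈ (σ.toFinset)ᶜ, D' (C.kgen n P k x) ≤ freshProb L.gen (C.F n P k) t h σ := by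
    have h2 : freshProb L.gen (C.F n P k) t h σ =
        expect D' (fun y => if IsFreshSample (C.F n P k) σ (List.ofFn y) then 1 else 0) := by
      have h3 := congrArg (fun μ => expect μ fun o => if ∃ z, o = some z ∧
        IsFreshSample (C.F n P k) σ z then (1 : ℝ≥0∞) else 0) hD'
      simp only [Prog.law, expect_map] at h3
      simp only [Option.some.injEq, exists_eq_left'] at h3
      rw [← h3, freshProb]
      congr 1
      funext c
      rcases c with ⟨_ | ⟨p, K⟩, s⟩ <;> simp [output]
    rw [h2, ← Finset.sum_image (f := fun y => D' y) (kgen_injective C P k).injOn]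
    refine (Finset.sum_le_sum fun y hy => ?_).trans (ENNReal.sum_le_tsum _)
    obtain ⟨x, hx, rfl⟩ := Finset.mem_image.1 hy
    have hfresh : IsFreshSample (C.F n P k) σ (List.ofFn (C.kgen n P k x)) :=
      isFreshSample_append (by simpa using hx)
    simp only [hfresh, if_true, mul_one, le_refl]
  refine le_trans ?_ h1
  -- The error terms are at most `1 / 10`, `1 / 10` and `9 / 100`.
  have h4 := le_sum_of_dKL_le (kgen_injective C P k) hd σ.toFinset (a := 10) (by norm_num)
  have h5 : ((σ.toFinset.card : ℝ)) / (Fintype.card (Bits n) : ℝ) ≤ 1 / 100 := by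
    have : (σ.toFinset.card : ℝ) ≤ σ.length := by exact_mod_cast σ.toFinset_card_le
    simp only [Fintype.card_pi, Fintype.card_bool, Finset.prod_const, Finset.card_univ,
      Fintype.card_fin, Nat.cast_pow, Nat.cast_ofNat]
    rw [div_le_iff₀ (by positivity)]
    linarith
  have h6 : Real.log 10 ≤ 10 - 1 := Real.log_le_sub_one_of_pos (by norm_num)
  have h7 : Real.log 2 ≤ 2 - 1 := Real.log_le_sub_one_of_pos (by norm_num)
  have h8 : Real.log 10 * ((σ.toFinset.card : ℝ) / (Fintype.card (Bits n) : ℝ)) ≤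
      (10 - 1) * (1 / 100) := by
    gcongr
  rw [← ENNReal.toReal_sum fun x _ => D'.apply_ne_top _] at h4
  refine ENNReal.ofReal_le_of_le_toReal ?_
  linarith

/-- If the learner succeeds, then so does the distinguisher, with large probability. -/
lemma le_learnProb (C : KeyedFunctions) {P k : List Bool} (hP : P ∈ C.params n) (hk : k ∈ C.key P)
    {L : GeneratorLearner} {T t : ℕ}
    (hL : L.IsPACLearner n (C.conceptClass n) (1 / 10) (1 / 10) SAMPLE dKL T t)
    (hT : (T : ℝ) ≤ 2 ^ n / 100) :
    ENNReal.ofReal (63 / 100) ≤ learnProb L.learn L.gen (C.F n P k) T t := by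
  classical
  have h := (hL (C.kdist n P k) ⟨P, hP, k, hk, rfl⟩).2
  have hO : ∀ (σ : List (Bits n)) (q : List Bool),
      (recordingSample (C.F n P k) σ).map Prod.fst = SAMPLE (C.kdist n P k) q := by
    intro σ q
    rw [recordingSample, SAMPLE, KeyedFunctions.kdist, PMF.map_comp, PMF.map_comp]
    congr 1
    funext x
    exact (ofFn_append_bin _ _).symm
  rw [← expect_indicator, Prog.law, expect_map,
    ← ssteps_map_fst hO T (([L.learn], initStore [unary n]), []), expect_map] at h
  calc ENNReal.ofReal (63 / 100) = ENNReal.ofReal (1 - 1 / 10) * ENNReal.ofReal (7 / 10) := by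
        rw [← ENNReal.ofReal_mul (by norm_num)]
        norm_num
    _ ≤ _ := by
        refine (mul_le_mul_left h _).trans ?_
        rw [← expect_mul_right, learnProb]
        refine expect_mono fun x hx => ?_
        have hlen := length_le_of_mem_support _ T _ hx
        split_ifs with h1 h2 h2
        · obtain ⟨z, hz, D', hgen, hd⟩ := h1
          have hz' : x.1.2 0 = z := by
            rcases x with ⟨⟨_ | ⟨p, K⟩, s⟩, σ⟩
            · simpa [output] using hz
            · simp [output] at hz
          rw [one_mul, hz']
          refine le_freshProb C hgen hd (le_trans ?_ hT)
          simpa using hlen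
        · obtain ⟨z, hz, -⟩ := h1
          rcases x with ⟨⟨_ | ⟨p, K⟩, s⟩, σ⟩
          · simp at h2
          · simp [output] at hz
        · simp
        · simp

lemma probReal_eq (C : KeyedFunctions) (A : Prog) (n t : ℕ) :
    C.probReal A n t = (expect (C.ig n) fun P => expect (C.randomKey P) fun k =>
      A.law (MQ (C.F n P k)) [P] t (some [true])).toReal := by
  simp only [KeyedFunctions.probReal, PMF.bind_apply, expect]

lemma probRandom_eq (C : KeyedFunctions) (A : Prog) (n t : ℕ) :
    C.probRandom A n t = (expect (C.ig n) fun P => expect (C.randomFunction n P) fun R =>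
      A.law (MQ R) [P] t (some [true])).toReal := by
  simp only [KeyedFunctions.probRandom, PMF.bind_apply, expect]

end fresh

/-! ### Time bounds -/

/-- The running time of the learner for `ε = δ = 1 / 10`, which bounds the size of its sample, is
negligible compared to the number of all points. -/
lemma eventually_pow_le (c : ℕ) :
    ∀ᶠ n : ℕ in atTop, ((c * (n + 20) ^ c : ℕ) : ℝ) ≤ 2 ^ n / 100 := by
  have h := (tendsto_pow_const_div_const_pow_of_one_lt c (r := (2 : ℝ)) (by norm_num)).comp
    (tendsto_add_atTop_nat 20)
  have hpos : (0 : ℝ) < 1 / (2 ^ 20 * 100 * (c + 1)) := by positivity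
  filter_upwards [h.eventually_lt_const hpos] with n hn
  simp only [Function.comp, Nat.cast_add, Nat.cast_ofNat] at hn
  rw [div_lt_div_iff₀ (by positivity) (by positivity), one_mul, pow_add] at hn
  push_cast
  have h1 : (c : ℝ) * ((n : ℝ) + 20) ^ c ≤ (c + 1) * ((n : ℝ) + 20) ^ c := by
    gcongr
    linarith
  linarith

end GeneratorLearning

theorem theorem1 (C : KeyedFunctions) (hC : C.ClassicalSecurePRF)
    (hcod : ∀ᶠ n : ℕ in atTop, ∀ P ∈ C.params n, 2 ≤ (C.cod P).card)
    (𝓛 : ℝ → ℝ → GeneratorLearner) (c : ℝ → ℝ → ℕ) :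
    ∀ᶠ n : ℕ in atTop, ¬ EfficientlyLearns 𝓛 c n (C.conceptClass n) SAMPLE dKL := by
  obtain ⟨M, trec, hM⟩ := hC.efficient.recovery
  set L := 𝓛 (1 / 10) (1 / 10) with hLdef
  set e := c (1 / 10) (1 / 10) with he
  set A := Prog.distinguisher M L.learn L.gen
  set Tpoly : Polynomial ℕ := Polynomial.C e * (Polynomial.X + Polynomial.C 20) ^ e with hTpoly
  set tpoly : Polynomial ℕ := Polynomial.C e * (Polynomial.X + Polynomial.C 1) ^ e with htpoly
  -- The clock of the distinguisher covers the time that it needs if the learner keeps its time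
  -- bounds.
  set clock : Polynomial ℕ := trec + (Polynomial.C 42 * Polynomial.X + Polynomial.C 18) * Tpoly +
    tpoly + Polynomial.C 34 * Polynomial.X + Polynomial.C 30 with hclock
  filter_upwards [hC.pseudorandom A clock (Polynomial.C 10) (by simp), hcod, eventually_pow_le e,
    eventually_ne_atTop 0] with n hprf hcod hT hn hlearn
  have hL := hlearn (1 / 10) (1 / 10) (by norm_num) (by norm_num) (by norm_num)
  rw [← hLdef, ← he] at hL
  have hfloor : ⌊(e : ℝ) * ((n : ℝ) + 1 / (1 / 10) + 1 / (1 / 10)) ^ e⌋₊ = e * (n + 20) ^ e := by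
    have : (e : ℝ) * ((n : ℝ) + 1 / (1 / 10) + 1 / (1 / 10)) ^ e =
        ((e * (n + 20) ^ e : ℕ) : ℝ) := by
      push_cast
      norm_num [add_assoc]
    rw [this, Nat.floor_natCast]
  rw [hfloor] at hL
  have hclock' : clock.eval n = trec.eval n + (42 * n + 18) * (e * (n + 20) ^ e) +
      e * (n + 1) ^ e + 34 * n + 30 := by
    simp [hclock, hTpoly, htpoly]
  -- An advantage of at least `63 / 100 - 1 / 2 > 1 / 10` contradicts pseudorandomness.
  have hreal : 63 / 100 ≤ C.probReal A n (clock.eval n) := by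
    rw [probReal_eq]
    refine (ENNReal.ofReal_le_iff_le_toReal ?_).1 ?_
    · refine ne_top_of_le_ne_top ENNReal.one_ne_top (expect_le fun P _ => expect_le fun k _ => ?_)
      exact PMF.coe_le_one _ _
    · refine le_expect fun P hP => le_expect fun k hk => ?_
      have hk' : k ∈ C.key P := by
        rwa [KeyedFunctions.randomKey, PMF.mem_support_uniformOfFinset_iff] at hk
      exact (le_learnProb C hP hk' hL hT).trans
        (le_law_distinguisher (hM n P hP) hn _ _ _ hclock'.ge)
  have hrandom : C.probRandom A n (clock.eval n) ≤ 1 / 2 := by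
    rw [probRandom_eq]
    refine ENNReal.toReal_le_of_le_ofReal (by norm_num) (expect_le fun P hP => ?_)
    have h1 := C.expect_learnProb_le (n := n) (C.cod_lt n P hP) (hcod P hP) L.learn L.gen
      (clock.eval n) (clock.eval n)
    refine (expect_mono fun R _ => law_distinguisher_le (hM n P hP) hn R L.learn L.gen
      (by omega)).trans ?_
    rw [ENNReal.ofReal_div_of_pos (by norm_num), ENNReal.ofReal_one, ENNReal.ofReal_ofNat]
    exact ENNReal.le_div_iff_mul_le (by simp) (by simp) |>.2 h1
  simp only [Polynomial.eval_C, Nat.cast_ofNat] at hprf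
  have := (abs_lt.1 hprf).2
  linarith
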